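/- All spaces are real. A Köthe function space on a $\sigma$-finite measure space $(\Omega,\mu)$ is a Banach space $X$ of ($\mu$-a.e. classes of) locally integrable real functions such that $|f|\le|g|$ a.e., $f$ measurable and $g\in X$ imply $f\in X$ and $\|f\|\le\|g\|$, and such that $\chi_A\in X$ whenever $\mu(A)<\infty$. Its Köthe dual $X'$ consists of all measurable $g$ with $\int|fg|\,d\mu<\infty$ for every $f\in X$, with the norm $\|g\|_{X'}=\sup_{\|f\|_X\le1}\int|fg|\,d\mu$. The space $X$ is rearrangement invariant (r.i.) if $X'$ is a norming subspace of $X^*$, if for every invertible measure-preserving map $\tau$ of $\Omega$ one has $f\in X$ if and only if $f\circ\tau\in X$, with $\|f\circ\tau\|_X=\|f\|_X$, and if $\|\chi_B\|_X=1$ whenever $\mu(B)=1$. Here $\Omega$ is $[0,1]$ with Lebesgue measure, or one of the sets $\{1,\dots,d\}$ and $\mathbb N$ with counting measure (sequence spaces, with unit vectors $e_i$). The space $X$ has property $(P')$ if for every $t>0$ $$\|\chi_{[0,1/2]}\|_{X'}<\|\chi_{[0,1/2]}+t\chi_{[1/2,1]}\|_{X'}\quad(\Omega=[0,1]),\qquad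 \|e_1\|_{X'}<\|e_1+te_2\|_{X'}\quad(\text{sequence spaces}).$$ If $\Omega=[0,1]$, let $e^n_i=\chi_{((i-1)2^{-n},\,i2^{-n}]}$ for $1\le i\le 2^n$, and let $X_n$ be the span of $e^n_1,\dots,e^n_{2^n}$ in $X$. If $\dim X=d<\infty$, let $X_n=X$ and $e^n_i=e_i$ ($1\le i\le d$) for all $n$. If $\Omega=\mathbb N$, let $X_n$ be the span of $e^n_i=e_i$, $1\le i\le 2^n$. For a Hilbert space $H$, $X_n(H)$ is the space of families $u=(u_i)_{1\le i\le\dim X_n}$ in $H$ with norm $\big\|\sum_i\|u_i\|_H\,e^n_i\big\|_X$. An element $u$ of a normed space $E$ is a Flinn element if there is $f\in E^*$, $f\ne0$, such that $f(x)\,x^*(u)\ge0$ for all $x\in E$ and $x^*\in E^*$ with $x^*(x)=\|x\|\,\|x^*\|$. **Proposition.** Let $H$ be a separable Hilbert space with $\dim H\ge2$. Let $X$ be an r.i. space on $[0,1]$, $\{1,\dots,d\}$ or $\mathbb N$, with property $(P')$ and $\dim X\ge3$, whose norm is not proportional to the $L_p$-norm for any $1\le p\le\infty$. Then there is $N\in\mathbb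 N$ such that for every $n\ge N$ and every Flinn element $u=(u_i)$ of $X_n(H)$ there is an index $i_0$ with $u_i=0$ for all $i\ne i_0$. -/

import Mathlib

open MeasureTheory Filter
open scoped ENNReal NNReal

/-- The (class of the) characteristic function of a measurable set. -/
noncomputable def chi {Ω : Type*} [MeasurableSpace Ω] (μ : Measure Ω) (A : Set Ω)
    (hA : MeasurableSet A) : Ω →ₘ[μ] ℝ :=
  AEEqFun.mk (A.indicator fun _ => (1 : ℝ))
    (stronglyMeasurable_const.indicator hA).aestronglyMeasurable

/-- A (real) Köthe function space `X` over `(Ω, μ)`: a Banach space of `μ`-a.e. classes of locally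
integrable real functions which is an order ideal with a monotone norm and contains the
characteristic functions of sets of finite measure. The space is encoded by its extended norm
`rho` on all measurable functions: `rho f` is the norm of `f` if `f ∈ X`, and `∞` if `f ∉ X`. -/
structure KotheSpace {Ω : Type*} [MeasurableSpace Ω] (μ : Measure Ω) where
  rho : (Ω →ₘ[μ] ℝ) → ℝ≥0∞
  rho_eq_zero : ∀ f, rho f = 0 → f = 0
  rho_smul : ∀ (c : ℝ) (f : Ω →ₘ[μ] ℝ), rho (c • f) = ‖c‖ₑ * rho f
  rho_add : ∀ f g : Ω →ₘ[μ] ℝ, rho (f + g) ≤ rho f + rho g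
  rho_mono : ∀ f g : Ω →ₘ[μ] ℝ, (∀ᵐ x ∂μ, |f x| ≤ |g x|) → rho f ≤ rho g
  rho_chi : ∀ (A : Set Ω) (hA : MeasurableSet A), μ A < ∞ → rho (chi μ A hA) < ∞
  locally_integrable : ∀ f, rho f < ∞ → ∀ A : Set Ω, MeasurableSet A → μ A < ∞ →
    IntegrableOn f A μ
  complete : ∀ s : ℕ → (Ω →ₘ[μ] ℝ), (∀ n, rho (s n) < ∞) →
    (∀ ε : ℝ≥0∞, 0 < ε → ∃ N, ∀ m ≥ N, ∀ n ≥ N, rho (s m - s n) < ε) →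
    ∃ f, rho f < ∞ ∧ Tendsto (fun n => rho (s n - f)) atTop (nhds 0)

/-- Finitely many pairwise disjoint measurable sets of positive finite measure. -/
structure Blocks {Ω : Type*} [MeasurableSpace Ω] (μ : Measure Ω) (ι : Type*) where
  set : ι → Set Ω
  measurable : ∀ i, MeasurableSet (set i)
  disjoint : Pairwise fun i j => Disjoint (set i) (set j)
  pos : ∀ i, 0 < μ (set i)
  finite : ∀ i, μ (set i) < ∞

namespace KotheSpace

variable {Ω : Type*} [MeasurableSpace Ω] {μ : Measure Ω}

/-- The norm of the Köthe dual `X'`, i.e. `sup { ∫ |f| |g| dμ : ‖f‖_X ≤ 1 }`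
(`∞` if `g ∉ X'`). -/
noncomputable def dualRho (X : KotheSpace μ) (g : Ω →ₘ[μ] ℝ) : ℝ≥0∞ :=
  ⨆ (f : Ω →ₘ[μ] ℝ) (_ : X.rho f ≤ 1), ∫⁻ x, ‖f x‖ₑ * ‖g x‖ₑ ∂μ

/-- `X` is rearrangement invariant: `X'` is a norming subspace of `X*`, the norm is invariant
under invertible measure preserving maps, and `‖χ_B‖ = 1` whenever `μ B = 1`. -/
structure IsRI (X : KotheSpace μ) : Prop where
  norming : ∀ f, X.rho f < ∞ →
    X.rho f = ⨆ (g : Ω →ₘ[μ] ℝ) (_ : X.dualRho g ≤ 1), ‖∫ x, f x * g x ∂μ‖ₑ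
  invariant : ∀ (τ : Ω ≃ᵐ Ω) (hτ : MeasurePreserving τ μ μ) (f : Ω →ₘ[μ] ℝ),
    X.rho (f.compMeasurePreserving τ hτ) = X.rho f
  normalized : ∀ (B : Set Ω) (hB : MeasurableSet B), μ B = 1 → X.rho (chi μ B hB) = 1

/-- The norm of `X` is a constant multiple of the `L_p`-norm (on all of `X`). -/
def ProportionalToLp (X : KotheSpace μ) (p : ℝ≥0∞) : Prop :=
  ∃ c : ℝ≥0, ∀ f, X.rho f < ∞ → X.rho f = c * eLpNorm f p μ

end KotheSpace

/-- Property (P) of a function norm `r` relative to two sets `A`, `B`: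
`r (χ_A) < r (χ_A + t χ_B)` for every `t > 0`. -/
def PropertyP {Ω : Type*} [MeasurableSpace Ω] {μ : Measure Ω} (r : (Ω →ₘ[μ] ℝ) → ℝ≥0∞)
    (A B : Set Ω) (hA : MeasurableSet A) (hB : MeasurableSet B) : Prop :=
  ∀ t : ℝ, 0 < t → r (chi μ A hA) < r (chi μ A hA + t • chi μ B hB)

namespace KotheSpace

/-- Property (P') for a function space on `[0,1]`: `X'` has (P) for `[0,1/2]` and `[1/2,1]`. -/
def PropertyP'Interval (X : KotheSpace (volume : Measure unitInterval)) : Prop :=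
  PropertyP X.dualRho {x | (x : ℝ) ≤ 1 / 2} {x | 1 / 2 ≤ (x : ℝ)}
    (measurableSet_le measurable_subtype_coe measurable_const)
    (measurableSet_le measurable_const measurable_subtype_coe)

/-- Property (P') for a `d`-dimensional sequence space: `X'` has (P) for the first two
coordinates. -/
def PropertyP'Fin {d : ℕ} (X : KotheSpace (Measure.count : Measure (Fin d))) : Prop :=
  PropertyP X.dualRho {i | (i : ℕ) = 0} {i | (i : ℕ) = 1} (.of_discrete) (.of_discrete)

/-- Property (P') for an infinite sequence space. -/
def PropertyP'Nat (X : KotheSpace (Measure.count : Measure ℕ)) : Prop :=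
  PropertyP X.dualRho {0} {1} (.of_discrete) (.of_discrete)

section BlockSpace

variable {Ω : Type*} [MeasurableSpace Ω] {μ : Measure Ω} {ι : Type*}

/-- The space `Y(H)`, where `Y` is the span in `X` of the functions `e i = χ_{B i}`, viewed as a
sequence space with basis `(e i)`: its elements are the families `v = (v i)` in `H`, with norm
`‖ ∑ i, ‖v i‖ • e i ‖_X`. -/
def BlockSpace (_X : KotheSpace μ) (_B : Blocks μ ι) (H : Type*) : Type _ := ι → H

variable (X : KotheSpace μ) (B : Blocks μ ι)
variable (H : Type*) [NormedAddCommGroup H]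

instance : AddCommGroup (X.BlockSpace B H) := inferInstanceAs (AddCommGroup (ι → H))

instance [InnerProductSpace ℝ H] : Module ℝ (X.BlockSpace B H) :=
  inferInstanceAs (Module ℝ (ι → H))

/-- The step function `∑ i, a i • χ_{B i}`. -/
noncomputable def step [Fintype ι] (B : Blocks μ ι) (a : ι → ℝ) : Ω →ₘ[μ] ℝ :=
  ∑ i, a i • chi μ (B.set i) (B.measurable i)

noncomputable instance [Fintype ι] : Norm (X.BlockSpace B H) :=
  ⟨fun v => (X.rho (step B fun i => ‖v i‖)).toReal⟩

theorem rho_zero : X.rho 0 = 0 := by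
  have h := X.rho_smul 0 0
  simpa using h

theorem step_coeFn [Fintype ι] (a : ι → ℝ) :
    ∀ᵐ x ∂μ, step B a x = ∑ i, a i * (B.set i).indicator (fun _ => (1 : ℝ)) x := by
  classical
  have key : ∀ s : Finset ι, ∀ᵐ x ∂μ,
      (∑ i ∈ s, a i • chi μ (B.set i) (B.measurable i) : Ω →ₘ[μ] ℝ) x
        = ∑ i ∈ s, a i * (B.set i).indicator (fun _ => (1 : ℝ)) x := by
    intro s
    induction s using Finset.induction_on with
    | empty =>
      simp only [Finset.sum_empty]
      exact AEEqFun.coeFn_zero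
    | insert i s hi ih =>
      rw [Finset.sum_insert hi]
      filter_upwards [ih, AEEqFun.coeFn_add (a i • chi μ (B.set i) (B.measurable i))
          (∑ i ∈ s, a i • chi μ (B.set i) (B.measurable i)),
        AEEqFun.coeFn_smul (a i) (chi μ (B.set i) (B.measurable i)),
        AEEqFun.coeFn_mk (μ := μ) ((B.set i).indicator fun _ => (1 : ℝ))
          (stronglyMeasurable_const.indicator (B.measurable i)).aestronglyMeasurable]
        with x h1 h2 h3 h4
      rw [h2, Pi.add_apply, h1, h3, Finset.sum_insert hi, Pi.smul_apply, chi, h4, smul_eq_mul]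
  exact key Finset.univ

theorem rho_step_lt_top [Fintype ι] (a : ι → ℝ) : X.rho (step B a) < ∞ := by
  classical
  have key : ∀ s : Finset ι,
      X.rho (∑ i ∈ s, a i • chi μ (B.set i) (B.measurable i)) < ∞ := by
    intro s
    induction s using Finset.induction_on with
    | empty => simp [X.rho_zero]
    | insert i s hi ih =>
      rw [Finset.sum_insert hi]
      refine (X.rho_add _ _).trans_lt (ENNReal.add_lt_top.2 ⟨?_, ih⟩)
      rw [X.rho_smul]
      exact ENNReal.mul_lt_top (by simp) (X.rho_chi _ _ (B.finite i))
  exact key Finset.univ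

theorem step_add [Fintype ι] (a b : ι → ℝ) :
    step B (fun i => a i + b i) = step B a + step B b := by
  simp [step, add_smul, Finset.sum_add_distrib]

theorem step_mul [Fintype ι] (c : ℝ) (a : ι → ℝ) :
    step B (fun i => c * a i) = c • step B a := by
  simp [step, mul_smul, Finset.smul_sum]

theorem rho_step_mono [Fintype ι] (a b : ι → ℝ) (ha : ∀ i, 0 ≤ a i) (h : ∀ i, a i ≤ b i) :
    X.rho (step B a) ≤ X.rho (step B b) := by
  apply X.rho_mono
  filter_upwards [step_coeFn B a, step_coeFn B b] with x h1 h2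
  have hi : ∀ i, 0 ≤ (B.set i).indicator (fun _ => (1 : ℝ)) x :=
    fun i => Set.indicator_nonneg (fun _ _ => zero_le_one) x
  rw [h1, h2, abs_of_nonneg (Finset.sum_nonneg fun i _ => mul_nonneg (ha i) (hi i)),
    abs_of_nonneg (Finset.sum_nonneg fun i _ => mul_nonneg ((ha i).trans (h i)) (hi i))]
  exact Finset.sum_le_sum fun i _ => mul_le_mul_of_nonneg_right (h i) (hi i)

theorem step_eq_zero [Fintype ι] (a : ι → ℝ) (ha : ∀ i, 0 ≤ a i) (h : step B a = 0) (i : ι) :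
    a i = 0 := by
  by_contra hne
  have h0 : ∀ᵐ x ∂μ, x ∉ B.set i := by
    have hz : ∀ᵐ x ∂μ, step B a x = 0 := by
      rw [h]
      exact AEEqFun.coeFn_zero
    filter_upwards [step_coeFn B a, hz] with x h1 h2 hx
    rw [h2] at h1
    have hi : ∀ i, 0 ≤ (B.set i).indicator (fun _ => (1 : ℝ)) x :=
      fun i => Set.indicator_nonneg (fun _ _ => zero_le_one) x
    have := (Finset.sum_eq_zero_iff_of_nonneg
      (fun i _ => mul_nonneg (ha i) (hi i))).1 h1.symm i (Finset.mem_univ i)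
    simp [hx, hne] at this
  have : μ (B.set i) = 0 := by simpa [ae_iff] using h0
  exact (B.pos i).ne' this

theorem blockSpace_core [Fintype ι] [InnerProductSpace ℝ H] :
    NormedSpace.Core ℝ (X.BlockSpace B H) where
  norm_nonneg _ := ENNReal.toReal_nonneg
  norm_smul c v := by
    change (X.rho (step B fun i => ‖c • v i‖)).toReal
      = ‖c‖ * (X.rho (step B fun i => ‖v i‖)).toReal
    simp only [norm_smul]
    rw [step_mul, X.rho_smul, ENNReal.toReal_mul]
    simp
  norm_triangle v w := by
    change (X.rho (step B fun i => ‖v i + w i‖)).toReal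
      ≤ (X.rho (step B fun i => ‖v i‖)).toReal + (X.rho (step B fun i => ‖w i‖)).toReal
    rw [← ENNReal.toReal_add (X.rho_step_lt_top B _).ne (X.rho_step_lt_top B _).ne]
    refine ENNReal.toReal_mono
      (ENNReal.add_lt_top.2 ⟨X.rho_step_lt_top B _, X.rho_step_lt_top B _⟩).ne ?_
    refine (X.rho_step_mono B _ (fun i => ‖v i‖ + ‖w i‖) (fun _ => norm_nonneg _)
      fun i => norm_add_le _ _).trans ?_
    rw [step_add]
    exact X.rho_add _ _
  norm_eq_zero_iff v := by
    change (X.rho (step B fun i => ‖v i‖)).toReal = 0 ↔ v = 0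
    constructor
    · intro h
      have h' : X.rho (step B fun i => ‖v i‖) = 0 :=
        ((ENNReal.toReal_eq_zero_iff _).1 h).resolve_right (X.rho_step_lt_top B _).ne
      funext i
      exact norm_eq_zero.1 (step_eq_zero B _ (fun _ => norm_nonneg _) (X.rho_eq_zero _ h') i)
    · rintro rfl
      have : step B (fun i => ‖(0 : X.BlockSpace B H) i‖) = 0 := by
        have h0 : ∀ i, (0 : X.BlockSpace B H) i = (0 : H) := fun _ => rfl
        simp [step, h0]
      rw [this, X.rho_zero]
      rfl

noncomputable instance [Fintype ι] [InnerProductSpace ℝ H] :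
    NormedAddCommGroup (X.BlockSpace B H) :=
  NormedAddCommGroup.ofCore (X.blockSpace_core B H)

noncomputable instance [Fintype ι] [InnerProductSpace ℝ H] :
    NormedSpace ℝ (X.BlockSpace B H) :=
  NormedSpace.ofCore (X.blockSpace_core B H)

end BlockSpace

end KotheSpace

/-- The dyadic intervals `(i / 2^n, (i+1) / 2^n]`, `0 ≤ i < 2^n`, of `[0,1]`. -/
noncomputable def dyadicBlocks (n : ℕ) :
    Blocks (volume : Measure unitInterval) (Fin (2 ^ n)) where
  set i := {x | (i : ℝ) / 2 ^ n < (x : ℝ) ∧ (x : ℝ) ≤ ((i : ℝ) + 1) / 2 ^ n}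
  measurable i := (measurableSet_lt measurable_const measurable_subtype_coe).inter
    (measurableSet_le measurable_subtype_coe measurable_const)
  disjoint := by
    intro i j hij
    rw [Set.disjoint_left]
    rintro x ⟨h1, h2⟩ ⟨h3, h4⟩
    have hp : (0 : ℝ) < 2 ^ n := by positivity
    rw [div_lt_iff₀ hp] at h1 h3
    rw [le_div_iff₀ hp] at h2 h4
    have ha : (i : ℝ) < (j : ℝ) + 1 := by linarith
    have hb : (j : ℝ) < (i : ℝ) + 1 := by linarith
    norm_cast at ha hb
    exact hij (Fin.ext (by omega))
  pos i := by
    have hp : (0 : ℝ) < 2 ^ n := by positivity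
    have hi : (i : ℝ) + 1 ≤ 2 ^ n := by
      have := i.isLt
      exact_mod_cast this
    have hmem : ∀ y : ℝ, (i : ℝ) / 2 ^ n < y → y ≤ ((i : ℝ) + 1) / 2 ^ n →
        y ∈ unitInterval := fun y h1 h2 =>
      ⟨(by positivity : (0 : ℝ) ≤ (i : ℝ) / 2 ^ n).trans h1.le,
        h2.trans ((div_le_one hp).2 hi)⟩
    have himg : ((↑) : unitInterval → ℝ) ''
        {x | (i : ℝ) / 2 ^ n < (x : ℝ) ∧ (x : ℝ) ≤ ((i : ℝ) + 1) / 2 ^ n}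
        = Set.Ioc ((i : ℝ) / 2 ^ n) (((i : ℝ) + 1) / 2 ^ n) := by
      ext y
      constructor
      · rintro ⟨x, hx, rfl⟩
        exact hx
      · intro hy
        exact ⟨⟨y, hmem y hy.1 hy.2⟩, hy, rfl⟩
    have hv : (volume : Measure unitInterval)
        {x | (i : ℝ) / 2 ^ n < (x : ℝ) ∧ (x : ℝ) ≤ ((i : ℝ) + 1) / 2 ^ n}
        = volume (Set.Ioc ((i : ℝ) / 2 ^ n) (((i : ℝ) + 1) / 2 ^ n)) := by
      rw [← himg]
      exact comap_subtype_coe_apply measurableSet_Icc volume _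
    rw [hv, Real.volume_Ioc, ENNReal.ofReal_pos, sub_pos]
    gcongr
    linarith
  finite i := measure_lt_top _ _

/-- The coordinates of a `d`-dimensional sequence space. -/
def finBlocks (d : ℕ) : Blocks (Measure.count : Measure (Fin d)) (Fin d) where
  set i := {i}
  measurable _ := .of_discrete
  disjoint i j h := by simpa using h
  pos i := by simp
  finite i := by simp

/-- The first `2^n` coordinates of an infinite sequence space. -/
def natBlocks (n : ℕ) : Blocks (Measure.count : Measure ℕ) (Fin (2 ^ n)) where
  set i := {(i : ℕ)}
  measurable _ := .of_discrete
  disjoint i j h := by simpa [Fin.ext_iff] using h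
  pos i := by simp
  finite i := by simp

/-- `u` is a Flinn element of the real normed space `E`. -/
def IsFlinn {E : Type*} [NormedAddCommGroup E] [NormedSpace ℝ E] (u : E) : Prop :=
  ∃ f : E →L[ℝ] ℝ, f ≠ 0 ∧ ∀ (x : E) (φ : E →L[ℝ] ℝ), φ x = ‖x‖ * ‖φ‖ → 0 ≤ f x * φ u

/-! Suppose a Flinn element u of X_n(H), with witness f, has two nonzero coordinates i ≠ j. If the
coefficients c norm a in X_n and the s_k are unit vectors of H, then v ↦ ∑ c_k⟨s_k, v_k⟩ norms (a_k
s_k), so (∑ a_k f_k(s_k)) · (∑ c_k⟨s_k, u_k⟩) ≥ 0 (`mul_nonneg_of_isSupport`). Taking a = e_k shows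
that f_k = w_k⟨·, u_k⟩ whenever u_k ≠ 0. Since dim H ≥ 2, the numbers ⟨s_k, u_k⟩/‖u_k‖ can be
prescribed freely in [-1, 1]; the inequality then says that two linear forms never have opposite
signs, hence are proportional. The constant vector, normed by a constant functional because of
symmetry, gives w_i = w_j, and f ≠ 0 makes this value nonzero. So (a_i, a_j) ∥ (c_i, c_j), and by
symmetry c ∥ a for every norming pair.

Such a norm is Euclidean (`eq_mul_sqrt_of_support`): along a unit circle it satisfies h(s) cos(t -
s) ≤ h(t), which forces h' = 0.

If this happened for arbitrarily large n, the normalization of X would fix the Euclidean constant,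
so the norm would be the L_2-norm on subspaces X_n whose union is dense in L_2. As X' is norming, it
would be the L_2-norm on all of X (`rho_eq_eLpNorm_two_of_dense`), which the case p = 2 of the
hypothesis excludes. -/

/-! ### Euclidean norms recognized by their supporting functionals -/

/-- A nonnegative function with `h s * cos (t - s) ≤ h t` for all `s`, `t` is constant. -/
theorem eq_of_mul_cos_sub_le {h : ℝ → ℝ} (h0 : ∀ t, 0 ≤ h t)
    (H : ∀ s t, h s * Real.cos (t - s) ≤ h t) (s t : ℝ) : h s = h t := by
  have hd : ∀ s, HasDerivAt h 0 s := by
    intro s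
    -- The hypothesis is used in both directions with cos x ≥ 1 - x²/2. For |t - s| < 1 this gives h
    -- t ≤ 2 h s, so h t - h s is quadratically small and the derivative vanishes.
    have hb : ∀ᶠ t in nhds s, ‖h t - h s‖ ≤ ‖h s * (t - s) ^ 2‖ := by
      filter_upwards [Metric.ball_mem_nhds s one_pos] with t ht
      rw [Metric.mem_ball, Real.dist_eq] at ht
      have hd2 : (t - s) ^ 2 ≤ 1 := by rw [sq_le_one_iff_abs_le_one]; exact ht.le
      have hc := Real.one_sub_sq_div_two_le_cos (x := t - s)
      have h1 := H s t
      have h2 := H t s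
      rw [← neg_sub, Real.cos_neg] at h2
      have h3 : h s * (1 - (t - s) ^ 2 / 2) ≤ h t :=
        (mul_le_mul_of_nonneg_left hc (h0 s)).trans h1
      have h4 : h t * (1 - (t - s) ^ 2 / 2) ≤ h s :=
        (mul_le_mul_of_nonneg_left hc (h0 t)).trans h2
      have h5 : h t ≤ 2 * h s := by nlinarith [h0 t]
      have h6 : 0 ≤ h s * (t - s) ^ 2 := mul_nonneg (h0 s) (sq_nonneg _)
      have h7 : h t * (t - s) ^ 2 ≤ 2 * h s * (t - s) ^ 2 :=
        mul_le_mul_of_nonneg_right h5 (sq_nonneg _)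
      rw [Real.norm_eq_abs, Real.norm_eq_abs, abs_of_nonneg h6, abs_le]
      constructor <;> nlinarith
    rw [hasDerivAt_iff_isLittleO]
    simp only [smul_zero, sub_zero]
    refine (Asymptotics.IsBigO.of_bound (g := fun t => h s * (t - s) ^ 2) 1
      (hb.mono fun t ht => by simpa using ht)).trans_isLittleO ?_
    refine Asymptotics.IsLittleO.const_mul_left ?_ _
    have := Asymptotics.isLittleO_pow_id (𝕜 := ℝ) (n := 2) one_lt_two
    have ht : Tendsto (fun t => t - s) (nhds s) (nhds 0) := by
      have : Tendsto (fun t => t - s) (nhds s) (nhds (s - s)) :=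
        (continuous_id.sub continuous_const).tendsto s
      simpa using this
    exact this.comp_tendsto ht
  exact is_const_of_deriv_eq_zero (fun x => (hd x).differentiableAt) (fun x => (hd x).deriv) s t

/-- A norm all of whose supporting functionals at `a` are multiples of `a` is Euclidean. -/
theorem eq_mul_sqrt_of_support {ι : Type*} [Fintype ι] [DecidableEq ι] {N : (ι → ℝ) → ℝ}
    (h0 : ∀ a, 0 ≤ N a) (hsmul : ∀ (c : ℝ) a, N (c • a) = |c| * N a)
    (H : ∀ a b, N a * ∑ i, a i * b i ≤ N b * ∑ i, a i ^ 2) (i : ι) (x : ι → ℝ) :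
    N x = N (Pi.single i 1) * √(∑ k, x k ^ 2) := by
  set e : ι → ℝ := Pi.single i 1 with he
  have hee : ∑ k, e k * e k = 1 := by simp [he, Pi.single_apply]
  set z : ι → ℝ := x - x i • e with hz
  have hzi : z i = 0 := by simp [hz, he]
  have hez : ∑ k, e k * z k = 0 := by simp [he, Pi.single_apply, hzi]
  have hx : x = x i • e + z := by simp [hz]
  set q := ∑ k, z k * z k with hq
  have hq0 : 0 ≤ q := Finset.sum_nonneg fun k _ => mul_self_nonneg _
  have hsum : ∀ p r p' r' : ℝ, ∑ k, (p • e + r • z) k * (p' • e + r' • z) k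
      = p * p' + r * r' * q := by
    intro p r p' r'
    calc ∑ k, (p • e + r • z) k * (p' • e + r' • z) k
        = p * p' * ∑ k, e k * e k + (p * r' + r * p') * ∑ k, e k * z k + r * r' * q := by
          rw [hq, Finset.mul_sum, Finset.mul_sum, Finset.mul_sum, ← Finset.sum_add_distrib,
            ← Finset.sum_add_distrib]
          refine Finset.sum_congr rfl fun k _ => ?_
          simp only [Pi.add_apply, Pi.smul_apply, smul_eq_mul]
          ring
      _ = _ := by rw [hee, hez]; ring
  have hxsq : ∑ k, x k ^ 2 = x i ^ 2 + q := by
    have := hsum (x i) 1 (x i) 1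
    rw [one_smul, ← hx] at this
    simp only [← pow_two] at this
    rw [this]
    ring
  rw [hxsq]
  rcases hq0.eq_or_lt with hq1 | hq1
  · have hz0 : z = 0 := by
      funext k
      have := (Finset.sum_eq_zero_iff_of_nonneg (fun k _ => mul_self_nonneg (z k))).1 hq1.symm k
        (Finset.mem_univ k)
      simpa using this
    rw [← hq1, add_zero, Real.sqrt_sq_eq_abs]
    conv_lhs => rw [hx, hz0, add_zero, hsmul]
    ring
  · have hsq : √q * √q = q := Real.mul_self_sqrt hq0
    have hsq0 : √q ≠ 0 := (Real.sqrt_pos.2 hq1).ne'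
    -- N along the unit circle of the plane of e and z, where √q is the Euclidean length of z. The
    -- points at angles s and t have inner product cos (t - s).
    set h : ℝ → ℝ := fun t => N (Real.cos t • e + (Real.sin t / √q) • z) with hh
    have hconst : ∀ s t, h s = h t := by
      refine eq_of_mul_cos_sub_le (fun t => h0 _) fun s t => ?_
      have hH := H (Real.cos s • e + (Real.sin s / √q) • z)
        (Real.cos t • e + (Real.sin t / √q) • z)
      have h1 : ∀ s t : ℝ, Real.sin s / √q * (Real.sin t / √q) * q = Real.sin s * Real.sin t := by
        intro s t
        rw [div_mul_div_comm, hsq, div_mul_cancel₀ _ hq1.ne']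
      simp only [pow_two] at hH
      rw [hsum, hsum, h1, h1, ← pow_two, ← pow_two, Real.cos_sq_add_sin_sq, mul_one] at hH
      rw [Real.cos_sub, mul_comm (Real.cos t), mul_comm (Real.sin t)]
      exact hH
    -- Polar coordinates of x in the plane of e and z, so that x is ‖w‖ times the point of the
    -- circle at angle `w.arg`.
    set w : ℂ := ⟨x i, √q⟩ with hw
    have hc : ‖w‖ * Real.cos w.arg = x i := Complex.norm_mul_cos_arg w
    have hs : ‖w‖ * Real.sin w.arg = √q := Complex.norm_mul_sin_arg w
    have hn : ‖w‖ = √(x i ^ 2 + q) := by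
      rw [Complex.norm_def, Complex.normSq_mk, hsq, pow_two]
    have hxw : x = ‖w‖ • (Real.cos w.arg • e + (Real.sin w.arg / √q) • z) := by
      rw [smul_add, smul_smul, smul_smul, hc, ← mul_div_assoc, hs, div_self hsq0, one_smul]
      exact hx
    have h00 : h 0 = N e := by simp [hh]
    rw [← hn, ← h00, hconst 0 w.arg]
    conv_lhs => rw [hxw, hsmul, abs_of_nonneg (norm_nonneg w)]
    ring

/-- Two linear forms in two variables whose product is nonnegative are proportional. -/
theorem mul_eq_mul_of_forall_mul_nonneg {α β γ δ : ℝ}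
    (h : ∀ x y : ℝ, 0 ≤ (α * x + β * y) * (γ * x + δ * y)) : α * δ = β * γ := by
  -- At y = 1 the product is a nonnegative quadratic polynomial in x, with discriminant (αδ - βγ)².
  have hd := discrim_le_zero (a := α * γ) (b := α * δ + β * γ) (c := β * δ) fun x => by
    have := h x 1
    nlinarith
  rw [discrim] at hd
  have : (α * δ - β * γ) ^ 2 ≤ 0 := by nlinarith
  nlinarith [pow_eq_zero_iff (two_ne_zero) |>.1 (le_antisymm this (sq_nonneg _))]

/-! ### Functionals on H with the sign of an inner product -/

section UnitVectors

variable {H : Type*} [NormedAddCommGroup H] [InnerProductSpace ℝ H]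

theorem exists_norm_eq_one_apply_eq_zero (hH : 2 ≤ Module.rank ℝ H) (l : H →ₗ[ℝ] ℝ) :
    ∃ v : H, ‖v‖ = 1 ∧ l v = 0 := by
  have hker : ∃ v : H, l v = 0 ∧ v ≠ 0 := by
    by_contra! hcon
    have hinj : Function.Injective l := (injective_iff_map_eq_zero l).2 hcon
    have h1 := LinearMap.lift_rank_le_of_injective l hinj
    rw [Module.rank_self, Cardinal.lift_one, Cardinal.lift_le_one_iff] at h1
    exact absurd (hH.trans h1) (by norm_num)
  obtain ⟨v, hv, hv0⟩ := hker
  refine ⟨‖v‖⁻¹ • v, ?_, by simp [hv]⟩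
  rw [norm_smul, norm_inv, norm_norm, inv_mul_cancel₀ (norm_ne_zero_iff.2 hv0)]

/-- If `l s * ⟪s, u⟫ ≥ 0` for all unit vectors `s`, then `l` vanishes on the orthogonal complement
of `u`. -/
theorem apply_eq_zero_of_mul_inner_nonneg {l : H →ₗ[ℝ] ℝ} {u : H} (hu : u ≠ 0)
    (h : ∀ s : H, ‖s‖ = 1 → 0 ≤ l s * inner ℝ s u) {v : H} (hv : inner ℝ v u = 0) : l v = 0 := by
  have h' : ∀ s : H, 0 ≤ l s * inner ℝ s u := by
    intro s
    rcases eq_or_ne s 0 with rfl | hs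
    · simp
    · have h1 := h (‖s‖⁻¹ • s) (by
        rw [norm_smul, norm_inv, norm_norm, inv_mul_cancel₀ (norm_ne_zero_iff.2 hs)])
      rw [map_smul, real_inner_smul_left, smul_eq_mul, mul_mul_mul_comm] at h1
      exact nonneg_of_mul_nonneg_right h1 (by positivity)
  have hn : 0 < ‖u‖ ^ 2 := by positivity
  -- On the plane of v and u, both l and ⟨·, u⟩ are linear forms in (x, y), the second without an
  -- x-term; proportionality kills l v.
  have hlin : ∀ x y : ℝ, 0 ≤ (l v * x + l u * y) * (0 * x + ‖u‖ ^ 2 * y) := by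
    intro x y
    have := h' (x • v + y • u)
    simp only [map_add, map_smul, inner_add_left, real_inner_smul_left, hv, smul_eq_mul,
      real_inner_self_eq_norm_sq] at this
    nlinarith
  have := mul_eq_mul_of_forall_mul_nonneg hlin
  simpa [hn.ne'] using this

/-- A unit vector with prescribed inner product with `u`, on which `l` behaves as a multiple of
the inner product with `u`. -/
theorem exists_unit_inner_eq (hH : 2 ≤ Module.rank ℝ H) {l : H →ₗ[ℝ] ℝ} {u : H}
    (h : ∀ s : H, ‖s‖ = 1 → 0 ≤ l s * inner ℝ s u) {p : ℝ} (hp : |p| ≤ 1) :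
    ∃ s : H, ‖s‖ = 1 ∧ inner ℝ s u = p * ‖u‖ ∧ l s = l u / ‖u‖ ^ 2 * (p * ‖u‖) := by
  rcases eq_or_ne u 0 with rfl | hu
  -- For u = 0 both prescribed values are 0 (the quotient by ‖u‖² is 0 too), so a unit vector in the
  -- kernel of l serves.
  · obtain ⟨v, hv, hv0⟩ := exists_norm_eq_one_apply_eq_zero hH l
    exact ⟨v, hv, by simp, by simp [hv0]⟩
  · obtain ⟨v, hv, hv0⟩ := exists_norm_eq_one_apply_eq_zero hH (innerₗ H u)
    have hvu : inner ℝ v u = 0 := by rw [real_inner_comm]; exact hv0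
    have hlv := apply_eq_zero_of_mul_inner_nonneg hu h hvu
    have hn : ‖u‖ ≠ 0 := norm_ne_zero_iff.2 hu
    have hp2 : 0 ≤ 1 - p ^ 2 := by
      rw [sub_nonneg, sq_le_one_iff_abs_le_one]
      exact hp
    refine ⟨(p / ‖u‖) • u + √(1 - p ^ 2) • v, ?_, ?_, ?_⟩
    · rw [← sq_eq_sq₀ (norm_nonneg _) zero_le_one, one_pow, norm_add_sq_real,
        real_inner_smul_left, real_inner_smul_right, real_inner_comm, hvu, norm_smul, norm_smul, hv,
        mul_one, Real.norm_eq_abs, Real.norm_eq_abs, sq_abs, Real.sq_sqrt hp2, mul_pow, sq_abs]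
      field_simp
      ring
    · rw [inner_add_left, real_inner_smul_left, real_inner_smul_left, hvu,
        real_inner_self_eq_norm_sq]
      field_simp
      ring
    · rw [map_add, map_smul, map_smul, hlv, smul_zero, add_zero, smul_eq_mul]
      field_simp

end UnitVectors

/-! ### Norming functionals of block spaces and symmetry -/

namespace KotheSpace

variable {Ω : Type*} [MeasurableSpace Ω] {μ : Measure Ω} {ι : Type*} [Fintype ι]
variable (X : KotheSpace μ) (B : Blocks μ ι)

theorem step_ae_eq_of_mem (a : ι → ℝ) : ∀ᵐ x ∂μ, ∀ i, x ∈ B.set i → step B a x = a i := by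
  filter_upwards [step_coeFn B a] with x hx i hi
  rw [hx, Finset.sum_eq_single i]
  · simp [hi]
  · intro j _ hj
    have : x ∉ B.set j := fun h => Set.disjoint_left.1 (B.disjoint hj) h hi
    simp [this]
  · simp

theorem step_ae_eq_zero (a : ι → ℝ) : ∀ᵐ x ∂μ, (∀ i, x ∉ B.set i) → step B a x = 0 := by
  filter_upwards [step_coeFn B a] with x hx h
  simp [hx, h]

theorem rho_step_congr_abs (a b : ι → ℝ) (h : ∀ i, |a i| = |b i|) :
    X.rho (step B a) = X.rho (step B b) := by
  have key : ∀ᵐ x ∂μ, |step B a x| = |step B b x| := by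
    filter_upwards [step_ae_eq_of_mem B a, step_ae_eq_of_mem B b, step_ae_eq_zero B a,
      step_ae_eq_zero B b] with x h1 h2 h3 h4
    by_cases hx : ∃ i, x ∈ B.set i
    · obtain ⟨i, hi⟩ := hx
      rw [h1 i hi, h2 i hi, h i]
    · push Not at hx
      rw [h3 hx, h4 hx]
  exact le_antisymm (X.rho_mono _ _ (key.mono fun _ h => h.le))
    (X.rho_mono _ _ (key.mono fun _ h => h.ge))

/-- The norm of `∑ i, a i • χ_{B i}` in `X`, as a function of the coefficients. -/
noncomputable def coeffNorm (a : ι → ℝ) : ℝ := (X.rho (step B a)).toReal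

theorem norm_blockSpace {H : Type*} [NormedAddCommGroup H] [InnerProductSpace ℝ H]
    (v : X.BlockSpace B H) : ‖v‖ = X.coeffNorm B fun i => ‖v i‖ := rfl

theorem coeffNorm_congr_abs {a b : ι → ℝ} (h : ∀ i, |a i| = |b i|) :
    X.coeffNorm B a = X.coeffNorm B b := by
  rw [coeffNorm, X.rho_step_congr_abs B a b h, coeffNorm]

/-- A family of real coefficients as an element of `Y(ℝ)`. -/
def toBlockSpace (a : ι → ℝ) : X.BlockSpace B ℝ := a

theorem norm_toBlockSpace (a : ι → ℝ) : ‖X.toBlockSpace B a‖ = X.coeffNorm B a :=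
  X.coeffNorm_congr_abs B fun i => by simp [toBlockSpace]

theorem coeffNorm_nonneg (a : ι → ℝ) : 0 ≤ X.coeffNorm B a := ENNReal.toReal_nonneg

theorem coeffNorm_smul (c : ℝ) (a : ι → ℝ) : X.coeffNorm B (c • a) = |c| * X.coeffNorm B a := by
  rw [← norm_toBlockSpace, ← norm_toBlockSpace]
  exact norm_smul c (X.toBlockSpace B a)

theorem coeffNorm_pos {a : ι → ℝ} (ha : a ≠ 0) : 0 < X.coeffNorm B a := by
  rw [← norm_toBlockSpace]
  exact norm_pos_iff.2 (show X.toBlockSpace B a ≠ 0 from ha)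

theorem coeffNorm_mono {a b : ι → ℝ} (h : ∀ i, |a i| ≤ |b i|) :
    X.coeffNorm B a ≤ X.coeffNorm B b := by
  rw [X.coeffNorm_congr_abs B (a := a) (b := fun i => |a i|) (by simp),
    X.coeffNorm_congr_abs B (a := b) (b := fun i => |b i|) (by simp)]
  exact ENNReal.toReal_mono (X.rho_step_lt_top B _).ne
    (X.rho_step_mono B _ _ (fun _ => abs_nonneg _) h)

/-- The coefficients `c` define a norm-one functional norming `∑ i, a i • χ_{B i}`. -/
def IsSupport (a c : ι → ℝ) : Prop :=
  (∀ b : ι → ℝ, ∑ i, c i * b i ≤ X.coeffNorm B b) ∧ ∑ i, c i * a i = X.coeffNorm B a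

/-- Hahn–Banach in the finite-dimensional space Y(ℝ), with the functional written in coordinates. -/
theorem exists_isSupport (a : ι → ℝ) : ∃ c, X.IsSupport B a c := by
  classical
  obtain ⟨g, hg1, hg2⟩ := exists_dual_vector'' ℝ (X.toBlockSpace B a)
  let g' : (ι → ℝ) →ₗ[ℝ] ℝ := g.toLinearMap
  have hg' : ∀ b : ι → ℝ, ∑ i, g' (Pi.single i 1) * b i = g (X.toBlockSpace B b) := by
    intro b
    have h1 := LinearMap.pi_apply_eq_sum_univ g' b
    have h2 : g' b = g (X.toBlockSpace B b) := rfl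
    rw [← h2, h1]
    refine Finset.sum_congr rfl fun i _ => ?_
    rw [smul_eq_mul, mul_comm]
    congr 2
    funext j
    simp [Pi.single_apply, eq_comm]
  refine ⟨fun i => g' (Pi.single i 1), fun b => ?_, ?_⟩
  · rw [hg', ← norm_toBlockSpace]
    refine (le_abs_self _).trans ?_
    have := g.le_of_opNorm_le hg1 (X.toBlockSpace B b)
    rwa [one_mul] at this
  · rw [hg', ← norm_toBlockSpace]
    exact hg2

/-- By monotonicity of the norm, discarding all coordinates but one is a contraction, so a multiple
of the coordinate functional norms the unit vector. -/
theorem isSupport_single [DecidableEq ι] (i : ι) :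
    X.IsSupport B (Pi.single i 1) (Pi.single i (X.coeffNorm B (Pi.single i 1))) := by
  constructor
  · intro b
    have h1 : ∑ j, (Pi.single i (X.coeffNorm B (Pi.single i 1)) : ι → ℝ) j * b j
        = X.coeffNorm B (Pi.single i 1) * b i := by simp [Pi.single_apply]
    rw [h1]
    calc X.coeffNorm B (Pi.single i 1) * b i ≤ |b i| * X.coeffNorm B (Pi.single i 1) := by
          rw [mul_comm]
          exact mul_le_mul_of_nonneg_right (le_abs_self _) (X.coeffNorm_nonneg B _)
      _ = X.coeffNorm B (b i • Pi.single i 1) := (X.coeffNorm_smul B _ _).symm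
      _ ≤ X.coeffNorm B b := by
          refine X.coeffNorm_mono B fun j => ?_
          by_cases hj : j = i
          · subst hj
            simp
          · simp [hj]
  · simp [Pi.single_apply]

/-- The norm of `∑ i, a i • χ_{B i}` does not depend on the order of the coefficients. -/
def IsSymmetric : Prop := ∀ (σ : Equiv.Perm ι) (a : ι → ℝ), X.rho (step B (a ∘ σ)) = X.rho (step B a)

variable {X B}

theorem IsSymmetric.coeffNorm_comp (hs : X.IsSymmetric B) (σ : Equiv.Perm ι) (a : ι → ℝ) :
    X.coeffNorm B (a ∘ σ) = X.coeffNorm B a := by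
  rw [coeffNorm, hs, coeffNorm]

theorem IsSymmetric.isSupport_comp (hs : X.IsSymmetric B) {a c : ι → ℝ} (h : X.IsSupport B a c)
    (σ : Equiv.Perm ι) : X.IsSupport B (a ∘ σ) (c ∘ σ) := by
  constructor
  · intro b
    have h1 := h.1 (b ∘ σ.symm)
    rw [hs.coeffNorm_comp, ← Equiv.sum_comp σ] at h1
    simpa using h1
  · rw [hs.coeffNorm_comp, ← h.2, ← Equiv.sum_comp σ (fun i => c i * a i)]
    rfl

/-- The constant vector is fixed by all permutations, so the average over the symmetric group of any
functional norming it still norms it, and this average has constant coefficients. -/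
theorem IsSymmetric.exists_isSupport_one [Nonempty ι] (hs : X.IsSymmetric B) :
    ∃ r : ℝ, 0 < r ∧ X.IsSupport B (fun _ => 1) (fun _ => r) := by
  classical
  obtain ⟨c, hc⟩ := X.exists_isSupport B (fun _ => (1 : ℝ))
  set D : ι → ℝ := fun k => ∑ σ : Equiv.Perm ι, c (σ k) with hD
  have hconst : ∀ k l, D k = D l := by
    intro k l
    rw [hD]
    simp only
    rw [← Equiv.sum_comp (Equiv.mulRight (Equiv.swap k l))]
    simp
  obtain ⟨k₀⟩ := ‹Nonempty ι›
  set P : ℝ := (Fintype.card (Equiv.Perm ι) : ℝ) with hP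
  have hP0 : 0 < P := by
    rw [hP]
    exact_mod_cast Fintype.card_pos
  have hsum : ∀ b : ι → ℝ, D k₀ * ∑ k, b k = ∑ σ : Equiv.Perm ι, ∑ k, c (σ k) * b k := by
    intro b
    rw [Finset.sum_comm, Finset.mul_sum]
    refine Finset.sum_congr rfl fun k _ => ?_
    rw [hconst k₀ k, hD, Finset.sum_mul]
  have h1 : ∀ b : ι → ℝ, D k₀ / P * ∑ k, b k ≤ X.coeffNorm B b := by
    intro b
    rw [div_mul_eq_mul_div, div_le_iff₀ hP0, hsum, mul_comm, hP]
    refine (Finset.sum_le_sum fun σ _ => (hs.isSupport_comp hc σ).1 b).trans ?_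
    simp
  have h2 : D k₀ / P * ∑ _k : ι, (1 : ℝ) = X.coeffNorm B fun _ => 1 := by
    rw [div_mul_eq_mul_div, div_eq_iff hP0.ne', hsum, mul_comm, hP]
    refine (Finset.sum_congr rfl fun σ _ => (hs.isSupport_comp hc σ).2).trans ?_
    simp [Function.comp_def]
  refine ⟨D k₀ / P, ?_, fun b => ?_, ?_⟩
  · have h3 : 0 < X.coeffNorm B fun _ => (1 : ℝ) :=
      X.coeffNorm_pos B fun h => one_ne_zero (congrFun h k₀)
    rw [← h2] at h3
    exact pos_of_mul_pos_left h3 (Finset.sum_nonneg fun _ _ => zero_le_one)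
  · rw [← Finset.mul_sum]
    exact h1 b
  · rw [← Finset.mul_sum]
    exact h2

/-! ### A Flinn element with two nonzero coordinates forces a Euclidean norm -/

section Flinn

variable {H : Type*} [NormedAddCommGroup H] [InnerProductSpace ℝ H]

/-- The `i`-th component of a functional on `Y(H)`. -/
noncomputable def component [DecidableEq ι] (f : X.BlockSpace B H →L[ℝ] ℝ) (i : ι) : H →ₗ[ℝ] ℝ :=
  (show (ι → H) →ₗ[ℝ] ℝ from f.toLinearMap).comp (LinearMap.single ℝ (fun _ : ι => H) i)

theorem apply_eq_sum_component [DecidableEq ι] (f : X.BlockSpace B H →L[ℝ] ℝ)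
    (v : X.BlockSpace B H) : f v = ∑ i, component f i (v i) := by
  let f' : (ι → H) →ₗ[ℝ] ℝ := f.toLinearMap
  have h1 : f v = f' (∑ i, Pi.single i (v i)) := by
    rw [Finset.univ_sum_single (fun i => v i)]
    rfl
  rw [h1, map_sum]
  rfl

/-- The Flinn condition is tested on x = (a_i s_i) and φ = ∑ c_i⟨s_i, ·⟩. As |⟨s_i, v_i⟩| ≤ ‖v_i‖,
monotonicity gives ‖φ‖ ≤ 1, while φ(x) = ∑ c_i a_i = ‖x‖. -/
theorem mul_nonneg_of_isSupport [DecidableEq ι] {u : X.BlockSpace B H}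
    {f : X.BlockSpace B H →L[ℝ] ℝ}
    (hf : ∀ (x : X.BlockSpace B H) (φ : X.BlockSpace B H →L[ℝ] ℝ), φ x = ‖x‖ * ‖φ‖ →
      0 ≤ f x * φ u)
    {a c : ι → ℝ} (h : X.IsSupport B a c) {s : ι → H} (hs : ∀ i, ‖s i‖ = 1) :
    0 ≤ (∑ i, a i * component f i (s i)) * ∑ i, c i * inner ℝ (s i) (u i) := by
  let x : X.BlockSpace B H := fun i => a i • s i
  let φ' : X.BlockSpace B H →ₗ[ℝ] ℝ :=
    { toFun := fun v => ∑ i, c i * inner ℝ (s i) (v i)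
      map_add' := fun v w => by
        rw [← Finset.sum_add_distrib]
        refine Finset.sum_congr rfl fun i _ => ?_
        rw [show (v + w) i = v i + w i from rfl, inner_add_right, mul_add]
      map_smul' := fun r v => by
        rw [RingHom.id_apply, smul_eq_mul, Finset.mul_sum]
        refine Finset.sum_congr rfl fun i _ => ?_
        rw [show (r • v) i = r • v i from rfl, real_inner_smul_right]
        ring }
  have hle : ∀ v, φ' v ≤ ‖v‖ := by
    intro v
    refine (h.1 fun i => inner ℝ (s i) (v i)).trans ?_
    rw [norm_blockSpace]
    refine X.coeffNorm_mono B fun i => ?_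
    have := abs_real_inner_le_norm (s i) (v i)
    rwa [hs, one_mul, ← abs_norm] at this
  have hbd : ∀ v, ‖φ' v‖ ≤ 1 * ‖v‖ := by
    intro v
    rw [one_mul, Real.norm_eq_abs, abs_le]
    refine ⟨?_, hle v⟩
    have := hle (-v)
    rw [map_neg, norm_neg] at this
    linarith
  let φ : X.BlockSpace B H →L[ℝ] ℝ := φ'.mkContinuous 1 hbd
  have hφ1 : ‖φ‖ ≤ 1 := φ'.mkContinuous_norm_le zero_le_one hbd
  have hφx : φ x = ‖x‖ := by
    change ∑ i, c i * inner ℝ (s i) (a i • s i) = _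
    rw [norm_blockSpace, X.coeffNorm_congr_abs B (b := a) fun i => by
      change |‖a i • s i‖| = _
      rw [norm_smul, hs, mul_one, abs_norm, Real.norm_eq_abs], ← h.2]
    refine Finset.sum_congr rfl fun i _ => ?_
    rw [real_inner_smul_right, real_inner_self_eq_norm_sq, hs]
    ring
  have hnorm : φ x = ‖x‖ * ‖φ‖ := by
    refine le_antisymm ?_ ?_
    · rw [mul_comm]
      exact (le_abs_self _).trans (φ.le_opNorm x)
    · rw [hφx]
      exact mul_le_of_le_one_right (norm_nonneg _) hφ1
  have := hf x φ hnorm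
  rw [apply_eq_sum_component] at this
  have hx : ∀ i, component f i (x i) = a i * component f i (s i) := by
    intro i
    change component f i (a i • s i) = _
    rw [map_smul, smul_eq_mul]
  simp only [hx] at this
  exact this

/-- If a Flinn element has two nonzero coordinates `i ≠ j`, then the supporting functionals `c` of
`a` satisfy `(a i, a j) ∥ (c i, c j)`. -/
theorem IsSymmetric.mul_eq_mul_of_isFlinn (hH : 2 ≤ Module.rank ℝ H) (hs : X.IsSymmetric B)
    {u : X.BlockSpace B H} (hu : IsFlinn u) {i j : ι} (hij : i ≠ j) (hi : u i ≠ 0)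
    (hj : u j ≠ 0) {a c : ι → ℝ} (h : X.IsSupport B a c) : a i * c j = a j * c i := by
  classical
  obtain ⟨f, hf0, hf⟩ := hu
  have : Nonempty ι := ⟨i⟩
  set l : ι → H →ₗ[ℝ] ℝ := component f with hl
  -- The case a = e_k, with c supported at k.
  have hsign : ∀ k (s : H), ‖s‖ = 1 → 0 ≤ l k s * inner ℝ s (u k) := by
    intro k s hs1
    have h1 := mul_nonneg_of_isSupport hf (X.isSupport_single B k) (s := fun _ => s)
      (fun _ => hs1)
    have hpos : 0 < X.coeffNorm B (Pi.single k 1) := X.coeffNorm_pos B (by simp)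
    simp only [Pi.single_apply, ite_mul, one_mul, zero_mul, Finset.sum_ite_eq',
      Finset.mem_univ, if_true] at h1
    rw [mul_left_comm] at h1
    exact nonneg_of_mul_nonneg_right h1 hpos
  set w : ι → ℝ := fun k => l k (u k) / ‖u k‖ ^ 2 with hw
  have hchoose : ∀ k (p : ℝ), |p| ≤ 1 → ∃ s : H, ‖s‖ = 1 ∧ inner ℝ s (u k) = p * ‖u k‖ ∧
      l k s = w k * (p * ‖u k‖) := fun k p hp => exists_unit_inner_eq hH (hsign k) hp
  have hni : 0 < ‖u i‖ := norm_pos_iff.2 hi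
  have hpair : ∀ k k' : ι, k ≠ k' → u k ≠ 0 → u k' ≠ 0 → ∀ a c : ι → ℝ, X.IsSupport B a c →
      a k * w k * c k' = a k' * w k' * c k := by
    intro k k' hkk hk hk' a c hac
    have hnk : 0 < ‖u k‖ := norm_pos_iff.2 hk
    have hnk' : 0 < ‖u k'‖ := norm_pos_iff.2 hk'
    refine mul_eq_mul_of_forall_mul_nonneg fun x y => ?_
    -- M scales (x, y) so that the prescribed cosines p lie in [-1, 1]; with p zero off k and k',
    -- both sums become linear forms in (x, y) divided by M.
    set M : ℝ := |x| / ‖u k‖ + |y| / ‖u k'‖ + 1 with hM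
    have hMp : 0 < M := by positivity
    set p : ι → ℝ := fun m => if m = k then x / ‖u k‖ / M else if m = k' then y / ‖u k'‖ / M
      else 0 with hp
    have hp1 : ∀ m, |p m| ≤ 1 := by
      intro m
      simp only [hp]
      split_ifs
      · rw [abs_div, abs_of_pos hMp, div_le_one hMp, abs_div, abs_norm, hM]
        have : 0 ≤ |y| / ‖u k'‖ := by positivity
        linarith
      · rw [abs_div, abs_of_pos hMp, div_le_one hMp, abs_div, abs_norm, hM]
        have : 0 ≤ |x| / ‖u k‖ := by positivity
        linarith
      · simp
    choose s hs1 hs2 hs3 using fun m => hchoose m (p m) (hp1 m)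
    have h1 := mul_nonneg_of_isSupport hf hac hs1
    have hsum : ∀ g : ι → ℝ, ∑ m, g m * (p m * ‖u m‖) = (g k * x + g k' * y) / M := by
      intro g
      rw [← Finset.sum_subset (Finset.subset_univ {k, k'}), Finset.sum_pair hkk]
      · simp only [hp, if_true, if_neg hkk.symm]
        field_simp
      · intro m _ hm
        simp only [Finset.mem_insert, Finset.mem_singleton, not_or] at hm
        simp [hp, hm.1, hm.2]
    rw [← hl] at h1
    simp only [hs2, hs3, ← mul_assoc (a _)] at h1
    rw [hsum (fun m => a m * w m), hsum c, div_mul_div_comm] at h1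
    have h2 := mul_nonneg h1 (mul_pos hMp hMp).le
    rwa [div_mul_cancel₀ _ (mul_pos hMp hMp).ne'] at h2
  obtain ⟨r, hr, hone⟩ := hs.exists_isSupport_one
  have hwij : ∀ k k' : ι, k ≠ k' → u k ≠ 0 → u k' ≠ 0 → w k = w k' := by
    intro k k' hkk hk hk'
    have := hpair k k' hkk hk hk' _ _ hone
    simpa [hr.ne'] using this
  -- If w_i = 0 then every w_k vanishes, and each component of f is shown to be zero, contradicting
  -- f ≠ 0.
  have hw0 : w i ≠ 0 := by
    intro hwi
    apply hf0
    have hwk : ∀ k, w k = 0 := by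
      intro k
      rcases eq_or_ne (u k) 0 with hk | hk
      · simp [hw, hk]
      · rcases eq_or_ne k i with rfl | hki
        · exact hwi
        · rw [hwij k i hki hk hi, hwi]
    have hlz : ∀ k (s : H), ‖s‖ = 1 → l k s = 0 := by
      intro k s hs1
      rcases eq_or_ne (u k) 0 with hk | hk
      · have hki : k ≠ i := fun h => hi (h ▸ hk)
        -- Since u_k = 0, s can be placed at k without changing the second factor, which is r p
        -- ‖u_i‖; the first factor is just l_k(s), the other terms carrying w = 0. Then p = ±1
        -- forces l_k(s) = 0.
        have hval : ∀ p : ℝ, |p| ≤ 1 → 0 ≤ l k s * (r * (p * ‖u i‖)) := by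
          intro p hp
          set q : ι → ℝ := Pi.single i p with hq
          have hq1 : ∀ m, |q m| ≤ 1 := by
            intro m
            rw [hq, Pi.single_apply]
            split_ifs
            · exact hp
            · simp
          choose t ht1 ht2 ht3 using fun m => hchoose m (q m) (hq1 m)
          have h1 := mul_nonneg_of_isSupport hf hone (s := Function.update t k s) (by
            intro m
            rcases eq_or_ne m k with rfl | hm
            · simp [hs1]
            · simp [hm, ht1])
          have e1 : ∑ m, 1 * component f m (Function.update t k s m) = l k s := by
            rw [Finset.sum_eq_single k]
            · simp [hl]
            · intro m _ hm
              rw [Function.update_of_ne hm, ← hl, ht3, hwk]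
              simp
            · simp
          have e2 : ∑ m, r * inner ℝ (Function.update t k s m) (u m) = r * (p * ‖u i‖) := by
            rw [Finset.sum_eq_single i]
            · rw [Function.update_of_ne hki.symm, ht2, hq, Pi.single_eq_same]
            · intro m _ hm
              rcases eq_or_ne m k with rfl | hmk
              · simp [hk]
              · rw [Function.update_of_ne hmk, ht2, hq, Pi.single_eq_of_ne hm]
                simp
            · simp
          rwa [e1, e2] at h1
        have hp := hval 1 (by simp)
        have hm := hval (-1) (by simp)
        have hrn : 0 < r * ‖u i‖ := mul_pos hr hni
        by_contra hne
        rcases lt_or_gt_of_ne hne with hlt | hgt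
        · nlinarith [mul_neg_of_neg_of_pos hlt hrn]
        · nlinarith [mul_pos hgt hrn]
      · obtain ⟨t, ht⟩ : ∃ t : ℝ, inner ℝ (s - t • u k) (u k) = 0 := by
          refine ⟨inner ℝ s (u k) / ‖u k‖ ^ 2, ?_⟩
          have : ‖u k‖ ≠ 0 := norm_ne_zero_iff.2 hk
          rw [inner_sub_left, real_inner_smul_left, real_inner_self_eq_norm_sq]
          field_simp
          ring
        have h1 := apply_eq_zero_of_mul_inner_nonneg hk (hsign k) ht
        have h2 : l k (u k) = 0 := by
          have := hwk k
          have hn : ‖u k‖ ≠ 0 := norm_ne_zero_iff.2 hk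
          simpa [hw, hn, hk] using this
        rw [map_sub, map_smul, h2, smul_zero, sub_zero] at h1
        exact h1
    ext v
    rw [apply_eq_sum_component]
    refine Finset.sum_eq_zero fun k _ => ?_
    rcases eq_or_ne (v k) 0 with hv | hv
    · rw [hv, map_zero]
    · have hn : ‖v k‖ ≠ 0 := norm_ne_zero_iff.2 hv
      have h1 := hlz k (‖v k‖⁻¹ • v k) (by rw [norm_smul, norm_inv, norm_norm, inv_mul_cancel₀ hn])
      rw [map_smul, smul_eq_mul] at h1
      simpa [hn] using h1
  have h1 := hpair i j hij hi hj a c h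
  rw [← hwij i j hij hi hj] at h1
  have h2 : w i * (a i * c j) = w i * (a j * c i) := by linarith
  exact mul_left_cancel₀ hw0 h2

/-- If `Y(H)` has a Flinn element with two nonzero coordinates, then `Y` is Euclidean. -/
theorem IsSymmetric.exists_coeffNorm_eq_of_isFlinn (hH : 2 ≤ Module.rank ℝ H)
    (hs : X.IsSymmetric B) {u : X.BlockSpace B H} (hu : IsFlinn u) {i j : ι} (hij : i ≠ j)
    (hi : u i ≠ 0) (hj : u j ≠ 0) :
    ∃ κ : ℝ, 0 ≤ κ ∧ ∀ a, X.coeffNorm B a = κ * √(∑ k, a k ^ 2) := by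
  classical
  have hall : ∀ a c : ι → ℝ, X.IsSupport B a c → ∀ k k', a k * c k' = a k' * c k := by
    intro a c hac k k'
    rcases eq_or_ne k k' with rfl | hkk
    · rfl
    -- Symmetric groups act transitively on ordered pairs of distinct indices, so the relation for
    -- (i, j) transfers to every (k, k').
    obtain ⟨σ, hσi, hσj⟩ : ∃ σ : Equiv.Perm ι, σ i = k ∧ σ j = k' := by
      have hne : Equiv.swap i k j ≠ k := by
        intro h
        rw [Equiv.swap_apply_eq_iff, Equiv.swap_apply_right] at h
        exact hij h.symm
      refine ⟨(Equiv.swap i k).trans (Equiv.swap (Equiv.swap i k j) k'), ?_, ?_⟩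
      · simp only [Equiv.trans_apply, Equiv.swap_apply_left]
        exact Equiv.swap_apply_of_ne_of_ne hne.symm hkk
      · simp
    have := hs.mul_eq_mul_of_isFlinn hH hu hij hi hj (hs.isSupport_comp hac σ)
    simpa [hσi, hσj] using this
  refine ⟨X.coeffNorm B (Pi.single i 1), X.coeffNorm_nonneg B _,
    eq_mul_sqrt_of_support (X.coeffNorm_nonneg B) (X.coeffNorm_smul B) (fun a b => ?_) i⟩
  obtain ⟨c, hc⟩ := X.exists_isSupport B a
  rw [← hc.2]
  calc (∑ k, c k * a k) * ∑ k, a k * b k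
      = ∑ k, ∑ m, c k * a k * (a m * b m) := Finset.sum_mul_sum _ _ _ _
    _ = ∑ k, ∑ m, a k ^ 2 * (c m * b m) := by
        refine Finset.sum_congr rfl fun k _ => Finset.sum_congr rfl fun m _ => ?_
        linear_combination a k * b m * hall a c hc m k
    _ = (∑ k, a k ^ 2) * ∑ m, c m * b m := (Finset.sum_mul_sum _ _ _ _).symm
    _ ≤ (∑ k, a k ^ 2) * X.coeffNorm B b :=
        mul_le_mul_of_nonneg_left (hc.1 b) (Finset.sum_nonneg fun k _ => sq_nonneg _)
    _ = _ := mul_comm _ _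

end Flinn

end KotheSpace

/-! ### From a dense subset of L_2 to all of X -/

/-- The `L_2`-norm of `f` is determined by the square integrable functions dominated by `f`. -/
theorem eLpNorm_two_le_of_forall_dominated {Ω : Type*} [MeasurableSpace Ω] {μ : Measure Ω}
    [SigmaFinite μ] (f : Ω →ₘ[μ] ℝ) (C : ℝ≥0∞)
    (h : ∀ φ : Ω →ₘ[μ] ℝ, MemLp φ 2 μ → (∀ᵐ x ∂μ, |φ x| ≤ |f x|) → eLpNorm φ 2 μ ≤ C) :
    eLpNorm f 2 μ ≤ C := by
  -- Truncation to sets of finite measure on which f is bounded; the truncations converge pointwise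
  -- to f and Fatou's lemma concludes.
  set A : ℕ → Set Ω := fun n => spanningSets μ n ∩ {x | |f x| ≤ n} with hA
  have hAm : ∀ n, MeasurableSet (A n) := fun n =>
    (measurableSet_spanningSets μ n).inter
      (measurableSet_le f.measurable.abs measurable_const)
  have hsm : ∀ n, StronglyMeasurable ((A n).indicator f) := fun n =>
    f.stronglyMeasurable.indicator (hAm n)
  have hb : ∀ n, eLpNorm ((A n).indicator f) 2 μ ≤ C := by
    intro n
    have heq := AEEqFun.coeFn_mk (μ := μ) _ (hsm n).aestronglyMeasurable
    rw [← eLpNorm_congr_ae heq]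
    refine h _ ?_ ?_
    · rw [memLp_congr_ae heq, memLp_indicator_iff_restrict (hAm n)]
      have hfin : IsFiniteMeasure (μ.restrict (A n)) := ⟨by
        rw [Measure.restrict_apply_univ]
        exact (measure_mono Set.inter_subset_left).trans_lt (measure_spanningSets_lt_top μ n)⟩
      refine MemLp.of_bound f.stronglyMeasurable.aestronglyMeasurable n ?_
      filter_upwards [ae_restrict_mem (hAm n)] with x hx
      exact hx.2
    · filter_upwards [heq] with x hx
      rw [hx]
      by_cases hxA : x ∈ A n <;> simp [hxA]
  refine (Lp.eLpNorm_lim_le_liminf_eLpNorm (f := fun n => (A n).indicator f)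
    (fun n => (hsm n).aestronglyMeasurable) f ?_).trans
    (liminf_le_of_le ⟨0, by simp⟩ fun b hb' => ?_)
  · refine Eventually.of_forall fun x => tendsto_const_nhds.congr' ?_
    obtain ⟨m, hm⟩ := exists_nat_ge |f x|
    filter_upwards [eventually_ge_atTop (max m (spanningSetsIndex μ x))] with n hn
    have hx : x ∈ A n := ⟨monotone_spanningSets μ (le_of_max_le_right hn)
      (mem_spanningSetsIndex μ x), hm.trans (by exact_mod_cast le_of_max_le_left hn)⟩
    simp [hx]
  · obtain ⟨n, hn⟩ := hb'.exists
    exact hn.trans (hb n)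

theorem lintegral_enorm_mul_le_eLpNorm_two {Ω : Type*} [MeasurableSpace Ω] {μ : Measure Ω}
    (f g : Ω →ₘ[μ] ℝ) :
    ∫⁻ x, ‖f x‖ₑ * ‖g x‖ₑ ∂μ ≤ eLpNorm f 2 μ * eLpNorm g 2 μ := by
  have h := ENNReal.lintegral_mul_le_Lp_mul_Lq μ (p := 2) (q := 2)
    ⟨by norm_num, by norm_num, by norm_num⟩ f.measurable.enorm.aemeasurable
    g.measurable.enorm.aemeasurable
  rw [eLpNorm_eq_lintegral_rpow_enorm_toReal two_ne_zero ENNReal.ofNat_ne_top,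
    eLpNorm_eq_lintegral_rpow_enorm_toReal two_ne_zero ENNReal.ofNat_ne_top]
  simpa using h

namespace KotheSpace

variable {Ω : Type*} [MeasurableSpace Ω] {μ : Measure Ω} {X : KotheSpace μ}

/-- Homogeneity extends the bound from the unit ball of X to every f. -/
theorem lintegral_mul_le_rho {g : Ω →ₘ[μ] ℝ} (hg : X.dualRho g ≤ 1) (f : Ω →ₘ[μ] ℝ) :
    ∫⁻ x, ‖f x‖ₑ * ‖g x‖ₑ ∂μ ≤ X.rho f := by
  rcases eq_or_ne (X.rho f) 0 with h0 | h0
  · rw [X.rho_eq_zero f h0]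
    have : ∫⁻ x, ‖(0 : Ω →ₘ[μ] ℝ) x‖ₑ * ‖g x‖ₑ ∂μ = 0 := by
      rw [lintegral_congr_ae (g := fun _ => 0), lintegral_zero]
      filter_upwards [AEEqFun.coeFn_zero (α := Ω) (μ := μ) (β := ℝ)] with x hx
      simp [hx]
    rw [this]
    exact zero_le
  rcases eq_or_ne (X.rho f) ∞ with ht | ht
  · rw [ht]
    exact le_top
  set r := (X.rho f).toReal with hr
  have hr0 : 0 < r := ENNReal.toReal_pos h0 ht
  have hrr : ‖r⁻¹‖ₑ = (X.rho f)⁻¹ := by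
    rw [enorm_inv hr0.ne', Real.enorm_eq_ofReal hr0.le, hr, ENNReal.ofReal_toReal ht]
  have h1 : X.rho (r⁻¹ • f) ≤ 1 := by
    rw [X.rho_smul, hrr, ENNReal.inv_mul_cancel h0 ht]
  have h2 : ∫⁻ x, ‖(r⁻¹ • f) x‖ₑ * ‖g x‖ₑ ∂μ ≤ 1 :=
    (le_iSup₂ (f := fun (f : Ω →ₘ[μ] ℝ) (_ : X.rho f ≤ 1) => ∫⁻ x, ‖f x‖ₑ * ‖g x‖ₑ ∂μ)
      (r⁻¹ • f) h1).trans hg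
  have h3 : ∫⁻ x, ‖(r⁻¹ • f) x‖ₑ * ‖g x‖ₑ ∂μ = (X.rho f)⁻¹ * ∫⁻ x, ‖f x‖ₑ * ‖g x‖ₑ ∂μ := by
    rw [← lintegral_const_mul' _ _ (ENNReal.inv_ne_top.2 h0)]
    refine lintegral_congr_ae ?_
    filter_upwards [AEEqFun.coeFn_smul r⁻¹ f] with x hx
    rw [hx, Pi.smul_apply, smul_eq_mul, enorm_mul, hrr, mul_assoc]
  rw [h3] at h2
  calc ∫⁻ x, ‖f x‖ₑ * ‖g x‖ₑ ∂μ
      = X.rho f * ((X.rho f)⁻¹ * ∫⁻ x, ‖f x‖ₑ * ‖g x‖ₑ ∂μ) := by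
        rw [← mul_assoc, ENNReal.mul_inv_cancel h0 ht, one_mul]
    _ ≤ X.rho f * 1 := by gcongr
    _ = X.rho f := mul_one _

theorem eLpNorm_le_eLpNorm_add_sub (f h : Ω →ₘ[μ] ℝ) :
    eLpNorm f 2 μ ≤ eLpNorm h 2 μ + eLpNorm (f - h : Ω →ₘ[μ] ℝ) 2 μ := by
  have heq : (f : Ω → ℝ) =ᵐ[μ] (h : Ω → ℝ) + ((f - h : Ω →ₘ[μ] ℝ) : Ω → ℝ) := by
    filter_upwards [AEEqFun.coeFn_sub f h] with x hx
    simp [hx]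
  rw [eLpNorm_congr_ae heq]
  exact eLpNorm_add_le h.aestronglyMeasurable (f - h).aestronglyMeasurable (by norm_num)

theorem eLpNorm_two_sub_comm (f h : Ω →ₘ[μ] ℝ) :
    eLpNorm (f - h : Ω →ₘ[μ] ℝ) 2 μ = eLpNorm (h - f : Ω →ₘ[μ] ℝ) 2 μ := by
  rw [eLpNorm_congr_ae (AEEqFun.coeFn_sub f h), eLpNorm_congr_ae (AEEqFun.coeFn_sub h f)]
  exact eLpNorm_sub_comm _ _ _ _

/-- If the norm of `X` agrees with the `L_2`-norm on a dense subset of `L_2`, and `X'` is norming,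
then it agrees with the `L_2`-norm on all of `X`. -/
theorem rho_eq_eLpNorm_two_of_dense [SigmaFinite μ]
    (hnorm : ∀ f, X.rho f < ∞ →
      X.rho f = ⨆ (g : Ω →ₘ[μ] ℝ) (_ : X.dualRho g ≤ 1), ‖∫ x, f x * g x ∂μ‖ₑ)
    (S : Set (Ω →ₘ[μ] ℝ)) (hfin : ∀ h ∈ S, X.rho h < ∞) (hS : ∀ h ∈ S, X.rho h = eLpNorm h 2 μ)
    (hdense : ∀ f : Ω →ₘ[μ] ℝ, MemLp f 2 μ → ∀ ε : ℝ≥0∞, ε ≠ 0 →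
      ∃ h ∈ S, eLpNorm (f - h : Ω →ₘ[μ] ℝ) 2 μ ≤ ε)
    (f : Ω →ₘ[μ] ℝ) (hf : X.rho f < ∞) : X.rho f = eLpNorm f 2 μ := by
  -- Elements of S approximating φ in L_2 converge a.e. along a subsequence, and Fatou's lemma
  -- carries the bound for them over to φ.
  have hmul : ∀ g : Ω →ₘ[μ] ℝ, X.dualRho g ≤ 1 → ∀ φ : Ω →ₘ[μ] ℝ, MemLp φ 2 μ →
      ∫⁻ x, ‖φ x‖ₑ * ‖g x‖ₑ ∂μ ≤ eLpNorm φ 2 μ := by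
    intro g hg φ hφ
    have hε : ∀ n : ℕ, ((n : ℝ≥0∞) + 1)⁻¹ ≠ 0 := fun n => by simp
    choose h hhS hh using fun n : ℕ => hdense φ hφ _ (hε n)
    have hlim0 : Tendsto (fun n : ℕ => ((n : ℝ≥0∞) + 1)⁻¹) atTop (nhds 0) := by
      have := (tendsto_add_atTop_iff_nat 1).2 ENNReal.tendsto_inv_nat_nhds_zero
      simpa using this
    have hlim : Tendsto (fun n => eLpNorm ((h n : Ω → ℝ) - (φ : Ω → ℝ)) 2 μ) atTop (nhds 0) := by
      refine tendsto_of_tendsto_of_tendsto_of_le_of_le tendsto_const_nhds hlim0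
        (fun _ => zero_le) fun n => ?_
      have := hh n
      rw [eLpNorm_two_sub_comm, eLpNorm_congr_ae (AEEqFun.coeFn_sub (h n) φ)] at this
      exact this
    obtain ⟨ns, hns, hae⟩ := (tendstoInMeasure_of_tendsto_eLpNorm two_ne_zero
      (fun n => (h n).aestronglyMeasurable) φ.aestronglyMeasurable hlim).exists_seq_tendsto_ae
    calc ∫⁻ x, ‖φ x‖ₑ * ‖g x‖ₑ ∂μ
        ≤ ∫⁻ x, liminf (fun k => ‖h (ns k) x‖ₑ * ‖g x‖ₑ) atTop ∂μ := by
          refine lintegral_mono_ae ?_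
          filter_upwards [hae] with x hx
          refine le_of_eq (Tendsto.liminf_eq ?_).symm
          exact ENNReal.Tendsto.mul_const ((continuous_enorm.tendsto _).comp hx) (Or.inr (by simp))
      _ ≤ liminf (fun k => ∫⁻ x, ‖h (ns k) x‖ₑ * ‖g x‖ₑ ∂μ) atTop :=
          lintegral_liminf_le fun k => (h (ns k)).measurable.enorm.mul g.measurable.enorm
      _ ≤ liminf (fun k => eLpNorm φ 2 μ + ((ns k : ℝ≥0∞) + 1)⁻¹) atTop := by
          refine liminf_le_liminf (Eventually.of_forall fun k => ?_)
          refine (lintegral_mul_le_rho hg (h (ns k))).trans ?_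
          rw [hS _ (hhS _)]
          refine (eLpNorm_le_eLpNorm_add_sub (h (ns k)) φ).trans ?_
          gcongr
          rw [eLpNorm_two_sub_comm]
          exact hh (ns k)
      _ = eLpNorm φ 2 μ := by
          refine Tendsto.liminf_eq ?_
          have := (tendsto_const_nhds (x := eLpNorm φ 2 μ)).add
            (hlim0.comp hns.tendsto_atTop)
          simpa using this
  -- Testing g against L_2-functions φ dominated by g itself gives ‖φ‖² ≤ ‖φ‖, hence ‖φ‖ ≤ 1.
  have hdual : ∀ g : Ω →ₘ[μ] ℝ, X.dualRho g ≤ 1 → eLpNorm g 2 μ ≤ 1 := by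
    intro g hg
    refine eLpNorm_two_le_of_forall_dominated g 1 fun φ hφ hle => ?_
    have h1 : eLpNorm φ 2 μ * eLpNorm φ 2 μ ≤ eLpNorm φ 2 μ := by
      refine le_trans ?_ (hmul g hg φ hφ)
      have h2 : eLpNorm φ 2 μ * eLpNorm φ 2 μ = ∫⁻ x, ‖φ x‖ₑ * ‖φ x‖ₑ ∂μ := by
        rw [eLpNorm_eq_lintegral_rpow_enorm_toReal two_ne_zero ENNReal.ofNat_ne_top,
          ← ENNReal.rpow_add_of_nonneg _ _ (by norm_num) (by norm_num)]
        norm_num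
        simp only [pow_two]
      rw [h2]
      refine lintegral_mono_ae ?_
      filter_upwards [hle] with x hx
      gcongr
      exact enorm_le_iff_norm_le.2 hx
    by_contra! hlt
    have h3 := ENNReal.mul_lt_mul_left (c := eLpNorm φ 2 μ) (zero_lt_one.trans hlt).ne' hφ.2.ne hlt
    rw [one_mul] at h3
    exact absurd h1 (not_le.2 h3)
  -- X' is norming and its unit ball lies in that of L_2, so Cauchy–Schwarz applies.
  have hupper : ∀ φ : Ω →ₘ[μ] ℝ, X.rho φ < ∞ → X.rho φ ≤ eLpNorm φ 2 μ := by
    intro φ hφ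
    rw [hnorm φ hφ]
    refine iSup₂_le fun g hg => ?_
    refine (enorm_integral_le_lintegral_enorm _).trans ?_
    simp only [enorm_mul]
    refine (lintegral_enorm_mul_le_eLpNorm_two φ g).trans ?_
    exact mul_le_of_le_one_right zero_le (hdual g hg)
  refine le_antisymm (hupper f hf) ?_
  refine eLpNorm_two_le_of_forall_dominated f _ fun φ hφ hle => ?_
  have hφf := X.rho_mono φ f hle
  refine le_trans ?_ hφf
  have hφfin := hφf.trans_lt hf
  refine ENNReal.le_of_forall_pos_le_add fun ε hε _ => ?_
  obtain ⟨h, hhS, hh⟩ := hdense φ hφ (ε / 2) (by simp [hε.ne'])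
  -- The upper bound, applied to the error, makes L_2-approximation an approximation in X as well.
  have hsub : X.rho (h - φ) ≤ ε / 2 := by
    refine (hupper _ ?_).trans ((eLpNorm_two_sub_comm h φ).le.trans hh)
    have h1 := X.rho_add h ((-1 : ℝ) • φ)
    rw [X.rho_smul] at h1
    have h2 : h + (-1 : ℝ) • φ = h - φ := by rw [neg_one_smul, sub_eq_add_neg]
    rw [h2] at h1
    refine h1.trans_lt (ENNReal.add_lt_top.2 ⟨hfin h hhS, ENNReal.mul_lt_top (by simp) hφfin⟩)
  calc eLpNorm φ 2 μ ≤ eLpNorm h 2 μ + eLpNorm (φ - h : Ω →ₘ[μ] ℝ) 2 μ :=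
        eLpNorm_le_eLpNorm_add_sub φ h
    _ ≤ X.rho h + ε / 2 := by rw [hS h hhS]; gcongr
    _ ≤ X.rho φ + ε / 2 + ε / 2 := by
        gcongr
        have := X.rho_add φ (h - φ)
        rw [add_sub_cancel] at this
        exact this.trans (by gcongr)
    _ = X.rho φ + ε := by rw [add_assoc, ENNReal.add_halves]

end KotheSpace

/-! ### Blocks of equal measure and rearrangement invariance -/

namespace KotheSpace

section Blocks

variable {Ω : Type*} [MeasurableSpace Ω] {μ : Measure Ω} {ι : Type*} [Fintype ι]
variable {X : KotheSpace μ} {B : Blocks μ ι}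

theorem eLpNorm_step_two {m : ℝ≥0∞} (hm : ∀ i, μ (B.set i) = m) (a : ι → ℝ) :
    eLpNorm (step B a) 2 μ = m ^ (1 / 2 : ℝ) * ENNReal.ofReal √(∑ i, a i ^ 2) := by
  have h1 : ∀ᵐ x ∂μ, ‖step B a x‖ₑ ^ (2 : ℝ)
      = ∑ i, (B.set i).indicator (fun _ => ENNReal.ofReal (a i ^ 2)) x := by
    filter_upwards [step_ae_eq_of_mem B a, step_ae_eq_zero B a] with x hx1 hx2
    by_cases hx : ∃ i, x ∈ B.set i
    · obtain ⟨i, hi⟩ := hx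
      rw [hx1 i hi, Finset.sum_eq_single i]
      · rw [Set.indicator_of_mem hi, ← sq_abs, ENNReal.ofReal_pow (abs_nonneg _),
          ← Real.enorm_eq_ofReal_abs]
        norm_num
      · intro j _ hj
        exact Set.indicator_of_notMem
          (fun h => Set.disjoint_left.1 (B.disjoint hj) h hi) _
      · simp
    · push Not at hx
      simp [hx2 hx, hx]
  rw [eLpNorm_eq_lintegral_rpow_enorm_toReal two_ne_zero ENNReal.ofNat_ne_top]
  simp only [ENNReal.toReal_ofNat]
  rw [lintegral_congr_ae h1, lintegral_finsetSum _ fun i _ =>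
    measurable_const.indicator (B.measurable i)]
  simp only [lintegral_indicator_const (B.measurable _), hm]
  rw [← Finset.sum_mul, ← ENNReal.ofReal_sum_of_nonneg fun i _ => sq_nonneg _,
    ENNReal.mul_rpow_of_nonneg _ _ (by norm_num), mul_comm, Real.sqrt_eq_rpow,
    ENNReal.ofReal_rpow_of_nonneg (Finset.sum_nonneg fun i _ => sq_nonneg _) (by norm_num)]

/-- If `Y(H)` has a Flinn element with two nonzero coordinates, then the norm of `X` is the
`L_2`-norm on `Y` as soon as it is on one nonzero element. -/
theorem IsSymmetric.rho_step_eq_eLpNorm_two {H : Type*} [NormedAddCommGroup H]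
    [InnerProductSpace ℝ H] (hH : 2 ≤ Module.rank ℝ H) (hs : X.IsSymmetric B) {m : ℝ≥0∞}
    (hm : ∀ i, μ (B.set i) = m) {a₀ : ι → ℝ} (ha₀ : a₀ ≠ 0)
    (hnorm : X.rho (step B a₀) = eLpNorm (step B a₀) 2 μ) {u : X.BlockSpace B H}
    (hu : IsFlinn u) (hu' : ¬ ∃ i₀, ∀ i, i ≠ i₀ → u i = 0) (a : ι → ℝ) :
    X.rho (step B a) = eLpNorm (step B a) 2 μ := by
  obtain ⟨k, hk⟩ : ∃ k, a₀ k ≠ 0 := Function.ne_iff.1 ha₀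
  obtain ⟨i, hi⟩ : ∃ i, u i ≠ 0 := by
    by_contra! h
    exact hu' ⟨k, fun i _ => h i⟩
  obtain ⟨j, hj⟩ : ∃ j, j ≠ i ∧ u j ≠ 0 := by
    by_contra! h
    exact hu' ⟨i, h⟩
  obtain ⟨κ, hκ, h⟩ := hs.exists_coeffNorm_eq_of_isFlinn hH hu hj.1 hj.2 hi
  have hrho : ∀ a, X.rho (step B a) = ENNReal.ofReal κ * ENNReal.ofReal √(∑ i, a i ^ 2) := by
    intro a
    rw [← ENNReal.ofReal_mul hκ, ← h, coeffNorm, ENNReal.ofReal_toReal (X.rho_step_lt_top B a).ne]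
  have hpos : 0 < ∑ i, a₀ i ^ 2 :=
    Finset.sum_pos' (fun _ _ => sq_nonneg _) ⟨k, Finset.mem_univ k, by positivity⟩
  -- The given element a₀ pins down the Euclidean constant.
  have hκm : ENNReal.ofReal κ = m ^ (1 / 2 : ℝ) := by
    rw [hrho, eLpNorm_step_two hm] at hnorm
    exact (ENNReal.mul_left_inj (by simpa using hpos) ENNReal.ofReal_ne_top).1 hnorm
  rw [hrho, eLpNorm_step_two hm, hκm]

/-- Transpositions generate the symmetric group, so it suffices that each one is induced by a
measure-preserving map. -/
theorem IsRI.isSymmetric_of_swap [DecidableEq ι] (hX : X.IsRI)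
    (h : ∀ k l : ι, ∃ τ : Ω ≃ᵐ Ω, MeasurePreserving τ μ μ ∧
      ∀ i, τ ⁻¹' B.set i = B.set (Equiv.swap k l i)) : X.IsSymmetric B := by
  intro σ
  induction σ using Equiv.Perm.swap_induction_on with
  | one => intro a; rfl
  | swap_mul f x y _ ih =>
    intro a
    rw [Equiv.Perm.coe_mul, ← Function.comp_assoc, ih]
    obtain ⟨τ, hτ, hτB⟩ := h x y
    rw [← hX.invariant τ hτ (step B a)]
    congr 1
    apply AEEqFun.ext
    filter_upwards [AEEqFun.coeFn_compMeasurePreserving (step B a) hτ,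
      step_coeFn B (a ∘ Equiv.swap x y), hτ.quasiMeasurePreserving.ae (step_coeFn B a)]
      with z h1 h2 h3
    rw [h1, h2, Function.comp_apply, h3,
      ← Equiv.sum_comp (Equiv.swap x y) fun i => a i * (B.set i).indicator (fun _ => (1 : ℝ)) (τ z)]
    refine Finset.sum_congr rfl fun i _ => ?_
    have hmem : τ z ∈ B.set (Equiv.swap x y i) ↔ z ∈ B.set i := by
      rw [← Set.mem_preimage, hτB, Equiv.swap_apply_self]
    by_cases hz : z ∈ B.set i <;> simp [hmem, hz]

end Blocks

section Count

theorem measurePreserving_count {α : Type*} [MeasurableSpace α] (e : α ≃ᵐ α) :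
    MeasurePreserving e (Measure.count : Measure α) Measure.count := by
  refine ⟨e.measurable, Measure.ext fun s hs => ?_⟩
  rw [e.map_apply, Measure.count_apply hs, Measure.count_apply (e.measurable hs)]
  congr 1
  exact Set.encard_preimage_of_bijective e.bijective s

/-- A permutation of a discrete space as a measurable equivalence. -/
def permMeasurableEquiv {α : Type*} [MeasurableSpace α] [DiscreteMeasurableSpace α]
    (e : Equiv.Perm α) : α ≃ᵐ α where
  toEquiv := e
  measurable_toFun := .of_discrete
  measurable_invFun := .of_discrete

theorem IsRI.isSymmetric_finBlocks {d : ℕ} {X : KotheSpace (Measure.count : Measure (Fin d))}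
    (hX : X.IsRI) : X.IsSymmetric (finBlocks d) := by
  refine hX.isSymmetric_of_swap fun k l =>
    ⟨permMeasurableEquiv (Equiv.swap k l), measurePreserving_count _, fun i => ?_⟩
  ext x
  change Equiv.swap k l x = i ↔ x = Equiv.swap k l i
  rw [Equiv.swap_apply_eq_iff]

theorem IsRI.isSymmetric_natBlocks {n : ℕ} {X : KotheSpace (Measure.count : Measure ℕ)}
    (hX : X.IsRI) : X.IsSymmetric (natBlocks n) := by
  refine hX.isSymmetric_of_swap fun k l =>
    ⟨permMeasurableEquiv (Equiv.swap (k : ℕ) (l : ℕ)), measurePreserving_count _, fun i => ?_⟩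
  ext x
  change Equiv.swap (k : ℕ) (l : ℕ) x = i ↔ x = (Equiv.swap k l i : Fin (2 ^ n))
  rw [Equiv.swap_apply_eq_iff, Fin.val_injective.swap_apply]

theorem rho_step_single {Ω : Type*} [MeasurableSpace Ω] {μ : Measure Ω} {ι : Type*} [Fintype ι]
    [DecidableEq ι] {X : KotheSpace μ} (hX : X.IsRI) (B : Blocks μ ι) (hm : ∀ i, μ (B.set i) = 1)
    (i : ι) : X.rho (step B (Pi.single i 1)) = eLpNorm (step B (Pi.single i 1)) 2 μ := by
  have h1 : step B (Pi.single i 1) = chi μ (B.set i) (B.measurable i) := by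
    rw [step, Finset.sum_eq_single i]
    · simp
    · intro j _ hj
      simp [hj]
    · simp
  rw [eLpNorm_step_two hm, h1, hX.normalized _ _ (hm i)]
  simp [Pi.single_apply]

end Count

end KotheSpace

/-! ### Interchanging dyadic intervals -/

/-- Two disjoint intervals of the same length in `[0,1]` can be interchanged by a measure preserving
involution that fixes all other points. -/
theorem exists_measurePreserving_swap_Ioc {a b r : ℝ} (ha : 0 ≤ a) (hab : a + r ≤ b)
    (hb : b + r ≤ 1) :
    ∃ τ : unitInterval ≃ᵐ unitInterval, MeasurePreserving τ volume volume ∧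
      (∀ x : unitInterval, (x : ℝ) ∈ Set.Ioc a (a + r) → (τ x : ℝ) = x + (b - a)) ∧
      (∀ x : unitInterval, (x : ℝ) ∈ Set.Ioc b (b + r) → (τ x : ℝ) = x - (b - a)) ∧
      ∀ x : unitInterval, (x : ℝ) ∉ Set.Ioc a (a + r) → (x : ℝ) ∉ Set.Ioc b (b + r) →
        (τ x : ℝ) = x := by
  classical
  set A := Set.Ioc a (a + r) with hA
  set C := Set.Ioc b (b + r) with hC
  have hAm : MeasurableSet A := measurableSet_Ioc
  have hCm : MeasurableSet C := measurableSet_Ioc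
  have hAC : Disjoint A C := by
    rw [Set.disjoint_left]
    rintro x ⟨_, h2⟩ ⟨h3, _⟩
    linarith
  set g : ℝ → ℝ := fun x => if x ∈ A then x + (b - a) else if x ∈ C then x - (b - a) else x with hg
  have gA : ∀ x ∈ A, g x = x + (b - a) := fun x hx => by simp [hg, hx]
  have gC : ∀ x ∈ C, g x = x - (b - a) := fun x hx => by
    have : x ∉ A := fun h => Set.disjoint_left.1 hAC h hx
    simp [hg, hx, this]
  have gR : ∀ x, x ∉ A → x ∉ C → g x = x := fun x hx hx' => by simp [hg, hx, hx']
  have mAC : ∀ x, x + (b - a) ∈ C ↔ x ∈ A := by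
    intro x
    constructor <;> rintro ⟨h1, h2⟩ <;> constructor <;> linarith
  have mCA : ∀ x, x - (b - a) ∈ A ↔ x ∈ C := by
    intro x
    constructor <;> rintro ⟨h1, h2⟩ <;> constructor <;> linarith
  have gg : ∀ x, g (g x) = x := by
    intro x
    by_cases hx : x ∈ A
    · rw [gA x hx, gC _ ((mAC x).2 hx)]
      ring
    · by_cases hx' : x ∈ C
      · rw [gC x hx', gA _ ((mCA x).2 hx')]
        ring
      · rw [gR x hx hx', gR x hx hx']
  have gm : Measurable g := Measurable.ite hAm (measurable_id.add_const _)
    (Measurable.ite hCm (measurable_id.sub_const _) measurable_id)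
  have gI : ∀ x ∈ Set.Icc (0 : ℝ) 1, g x ∈ Set.Icc (0 : ℝ) 1 := by
    intro x hx
    by_cases hxA : x ∈ A
    · rw [gA x hxA]
      constructor <;> linarith [hxA.1, hxA.2]
    · by_cases hxC : x ∈ C
      · rw [gC x hxC]
        constructor <;> linarith [hxC.1, hxC.2]
      · rw [gR x hxA hxC]
        exact hx
  have gpre : g ⁻¹' Set.Icc (0 : ℝ) 1 = Set.Icc 0 1 := by
    ext x
    exact ⟨fun h => gg x ▸ gI _ h, gI x⟩
  have gvol : MeasurePreserving g volume volume := by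
    refine ⟨gm, Measure.ext fun s hs => ?_⟩
    rw [Measure.map_apply gm hs]
    -- The preimage exchanges the parts in A and C up to translation and leaves the remainder
    -- unchanged.
    have split : ∀ t : Set ℝ, volume t = volume (t ∩ A) + (volume (t \ A ∩ C)
        + volume ((t \ A) \ C)) := fun t => by
      rw [measure_inter_add_sdiff _ hCm, measure_inter_add_sdiff _ hAm]
    have e1 : g ⁻¹' s ∩ A = (fun x => x + (b - a)) ⁻¹' (s \ A ∩ C) := by
      ext x
      simp only [Set.mem_inter_iff, Set.mem_preimage, Set.mem_sdiff, mAC]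
      constructor
      · rintro ⟨h1, h2⟩
        rw [gA x h2] at h1
        exact ⟨⟨h1, fun h => Set.disjoint_left.1 hAC h ((mAC x).2 h2)⟩, h2⟩
      · rintro ⟨⟨h1, _⟩, h2⟩
        exact ⟨by rwa [gA x h2], h2⟩
    have e2 : g ⁻¹' s \ A ∩ C = (fun x => x + -(b - a)) ⁻¹' (s ∩ A) := by
      ext x
      simp only [Set.mem_inter_iff, Set.mem_preimage, Set.mem_sdiff, ← sub_eq_add_neg, mCA]
      constructor
      · rintro ⟨⟨h1, _⟩, h2⟩
        rw [gC x h2] at h1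
        exact ⟨h1, h2⟩
      · rintro ⟨h1, h2⟩
        exact ⟨⟨by rwa [gC x h2], fun h => Set.disjoint_left.1 hAC h h2⟩, h2⟩
    have e3 : (g ⁻¹' s \ A) \ C = (s \ A) \ C := by
      ext x
      simp only [Set.mem_preimage, Set.mem_sdiff]
      constructor
      · rintro ⟨⟨h1, h2⟩, h3⟩
        rw [gR x h2 h3] at h1
        exact ⟨⟨h1, h2⟩, h3⟩
      · rintro ⟨⟨h1, h2⟩, h3⟩
        exact ⟨⟨by rwa [gR x h2 h3], h2⟩, h3⟩
    rw [split (g ⁻¹' s), split s, e1, e2, e3, measure_preimage_add_right,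
      measure_preimage_add_right, add_left_comm]
  have gvolI : MeasurePreserving g (volume.restrict (Set.Icc 0 1))
      (volume.restrict (Set.Icc 0 1)) := by
    have := gvol.restrict_preimage (measurableSet_Icc (a := (0 : ℝ)) (b := 1))
    rwa [gpre] at this
  let t : unitInterval → unitInterval := fun x => ⟨g x, gI x x.2⟩
  have tm : Measurable t := (gm.comp measurable_subtype_coe).subtype_mk
  have tt : Function.Involutive t := fun x => Subtype.ext (gg x)
  let τ : unitInterval ≃ᵐ unitInterval :=
    { toEquiv := tt.toPerm
      measurable_toFun := tm
      measurable_invFun := tm }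
  refine ⟨τ, ⟨τ.measurable, Measure.ext fun s hs => ?_⟩, fun x hx => gA x hx, fun x hx => gC x hx,
    fun x hx hx' => gR x hx hx'⟩
  obtain ⟨s', hs', rfl⟩ := hs
  have e : τ ⁻¹' (Subtype.val ⁻¹' s') = Subtype.val ⁻¹' (g ⁻¹' s') := rfl
  rw [τ.map_apply, e,
    unitInterval.measurePreserving_coe.measure_preimage (gm hs').nullMeasurableSet,
    unitInterval.measurePreserving_coe.measure_preimage hs'.nullMeasurableSet]
  exact gvolI.measure_preimage hs'.nullMeasurableSet

theorem exists_measurePreserving_swap_dyadicBlocks (n : ℕ) (k l : Fin (2 ^ n)) :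
    ∃ τ : unitInterval ≃ᵐ unitInterval, MeasurePreserving τ volume volume ∧
      ∀ i, τ ⁻¹' (dyadicBlocks n).set i = (dyadicBlocks n).set (Equiv.swap k l i) := by
  wlog hkl : k < l generalizing k l
  · rcases (not_lt.1 hkl).eq_or_lt with h | h
    · subst h
      exact ⟨MeasurableEquiv.refl _, MeasurePreserving.id _, fun i => by
        rw [Equiv.swap_self]
        rfl⟩
    · obtain ⟨τ, hτ, hτ'⟩ := this l k h
      exact ⟨τ, hτ, fun i => by rw [hτ', Equiv.swap_comm]⟩
  have hp : (0 : ℝ) < 2 ^ n := by positivity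
  have hmem : ∀ (i : Fin (2 ^ n)) (x : unitInterval), x ∈ (dyadicBlocks n).set i ↔
      (x : ℝ) ∈ Set.Ioc ((i : ℝ) / 2 ^ n) ((i : ℝ) / 2 ^ n + 1 / 2 ^ n) := by
    intro i x
    rw [← add_div]
    rfl
  obtain ⟨τ, hτ, h1, h2, h3⟩ := exists_measurePreserving_swap_Ioc
    (a := (k : ℝ) / 2 ^ n) (b := (l : ℝ) / 2 ^ n) (r := 1 / 2 ^ n) (by positivity)
    (by
      rw [← add_div]
      gcongr
      exact_mod_cast hkl)
    (by
      rw [← add_div, div_le_one hp]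
      exact_mod_cast l.isLt)
  have huniq : ∀ (i j : Fin (2 ^ n)) (x : unitInterval), x ∈ (dyadicBlocks n).set i →
      (x ∈ (dyadicBlocks n).set j ↔ j = i) := by
    intro i j x hi
    refine ⟨fun hj => ?_, fun h => h ▸ hi⟩
    by_contra hne
    exact Set.disjoint_left.1 ((dyadicBlocks n).disjoint hne) hj hi
  refine ⟨τ, hτ, fun i => ?_⟩
  ext x
  rw [Set.mem_preimage]
  by_cases hk : x ∈ (dyadicBlocks n).set k
  · have hx := (hmem k x).1 hk
    have hτx : τ x ∈ (dyadicBlocks n).set l := by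
      rw [hmem, h1 x hx]
      constructor <;> linarith [hx.1, hx.2]
    rw [huniq l i _ hτx, huniq k _ _ hk, Equiv.swap_apply_eq_iff, Equiv.swap_apply_left]
  · by_cases hl : x ∈ (dyadicBlocks n).set l
    · have hx := (hmem l x).1 hl
      have hτx : τ x ∈ (dyadicBlocks n).set k := by
        rw [hmem, h2 x hx]
        constructor <;> linarith [hx.1, hx.2]
      rw [huniq k i _ hτx, huniq l _ _ hl, Equiv.swap_apply_eq_iff, Equiv.swap_apply_right]
    · have hτx : τ x = x := Subtype.ext (h3 x (mt (hmem k x).2 hk) (mt (hmem l x).2 hl))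
      rw [hτx]
      rcases eq_or_ne i k with rfl | hik
      · simp [hk, hl]
      · rcases eq_or_ne i l with rfl | hil
        · simp [hk, hl]
        · rw [Equiv.swap_apply_of_ne_of_ne hik hil]

/-- Only 0 is missed: the intervals being open on the left, x > 0 lies in the one with index ⌈2^n x⌉
- 1. -/
theorem ae_exists_mem_dyadicBlocks (n : ℕ) :
    ∀ᵐ x : unitInterval, ∃ i, x ∈ (dyadicBlocks n).set i := by
  have h0 : ∀ᵐ x : unitInterval, x ≠ 0 := by simp [ae_iff]
  filter_upwards [h0] with x hx
  have hp : (0 : ℝ) < 2 ^ n := by positivity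
  have hx0 : 0 < (x : ℝ) := lt_of_le_of_ne x.2.1 fun h => hx (Subtype.ext h.symm)
  have hy : 0 < (x : ℝ) * 2 ^ n := mul_pos hx0 hp
  obtain ⟨m, hm⟩ : ∃ m, ⌈(x : ℝ) * 2 ^ n⌉₊ = m + 1 :=
    Nat.exists_eq_succ_of_ne_zero (Nat.ceil_pos.2 hy).ne'
  have hle : (x : ℝ) * 2 ^ n ≤ m + 1 := by
    have := Nat.le_ceil ((x : ℝ) * 2 ^ n)
    rw [hm] at this
    exact_mod_cast this
  have hlt : (m : ℝ) < (x : ℝ) * 2 ^ n := by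
    rw [← Nat.lt_ceil, hm]
    exact Nat.lt_succ_self m
  have hm2 : m < 2 ^ n := by
    have : (m : ℝ) < 2 ^ n := hlt.trans_le (mul_le_of_le_one_left hp.le x.2.2)
    exact_mod_cast this
  exact ⟨⟨m, hm2⟩, (div_lt_iff₀ hp).2 hlt, (le_div_iff₀ hp).2 hle⟩

/-! ### Density of step functions and the normalization of X -/

namespace KotheSpace

theorem exists_step_dyadicBlocks_eLpNorm_sub_le (f : unitInterval →ₘ[volume] ℝ)
    (hf : MemLp f 2 volume) {ε : ℝ≥0∞} (hε : ε ≠ 0) :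
    ∃ N : ℕ, ∀ n ≥ N, ∃ a, eLpNorm
      (f - step (dyadicBlocks n) a : unitInterval →ₘ[volume] ℝ) 2 volume ≤ ε := by
  obtain ⟨g, hg, -⟩ := hf.exists_boundedContinuous_eLpNorm_sub_le ENNReal.ofNat_ne_top
    (ENNReal.half_pos hε).ne'
  obtain ⟨δ, hδ, hδε⟩ : ∃ δ : ℝ, 0 < δ ∧ ENNReal.ofReal δ ≤ ε / 2 := by
    obtain ⟨δ, hδ, h⟩ := ENNReal.lt_iff_exists_nnreal_btwn.1 (ENNReal.half_pos hε)
    exact ⟨δ, by exact_mod_cast hδ, by simpa using h.le⟩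
  obtain ⟨η, hη, hgη⟩ := Metric.uniformContinuous_iff.1
    (CompactSpace.uniformContinuous_of_continuous g.continuous) δ hδ
  obtain ⟨N, hN⟩ := exists_pow_lt_of_lt_one hη (show (1 / 2 : ℝ) < 1 by norm_num)
  refine ⟨N, fun n hn => ?_⟩
  have hp : (0 : ℝ) < 2 ^ n := by positivity
  have hnη : 1 / 2 ^ n < η := by
    rw [← one_div_pow]
    exact (pow_le_pow_of_le_one (by norm_num) (by norm_num) hn).trans_lt hN
  -- Right endpoints as sample points: by uniform continuity the sampled g is within δ of g on each
  -- interval.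
  let y : Fin (2 ^ n) → unitInterval := fun i => ⟨((i : ℝ) + 1) / 2 ^ n, by positivity, by
    rw [div_le_one hp]
    exact_mod_cast i.isLt⟩
  refine ⟨fun i => g (y i), ?_⟩
  have heq : (f - step (dyadicBlocks n) fun i => g (y i) : unitInterval →ₘ[volume] ℝ)
      =ᵐ[volume] ((f : unitInterval → ℝ) - (g : unitInterval → ℝ))
        + ((g : unitInterval → ℝ) - (step (dyadicBlocks n) fun i => g (y i) : unitInterval → ℝ)) := by
    filter_upwards [AEEqFun.coeFn_sub f (step (dyadicBlocks n) fun i => g (y i))] with x hx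
    simp [hx]
  rw [eLpNorm_congr_ae heq, ← ENNReal.add_halves ε]
  have hgm : AEStronglyMeasurable (g : unitInterval → ℝ) volume :=
    g.continuous.aestronglyMeasurable
  refine (eLpNorm_add_le (f.aestronglyMeasurable.sub hgm)
    (hgm.sub (AEEqFun.aestronglyMeasurable _)) (by norm_num)).trans (add_le_add hg ?_)
  refine (eLpNorm_le_of_ae_bound (C := δ) ?_).trans ?_
  · filter_upwards [ae_exists_mem_dyadicBlocks n,
      step_ae_eq_of_mem (dyadicBlocks n) fun i => g (y i)] with x ⟨i, hi⟩ hx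
    rw [Pi.sub_apply, hx i hi, ← dist_eq_norm]
    refine (hgη ?_).le
    rw [Subtype.dist_eq, Real.dist_eq, abs_sub_comm, abs_of_nonneg (sub_nonneg.2 hi.2)]
    have h1 := hi.1
    have h2 : ((i : ℝ) + 1) / 2 ^ n = (i : ℝ) / 2 ^ n + 1 / 2 ^ n := add_div _ _ _
    change ((i : ℝ) + 1) / 2 ^ n - x < η
    linarith
  · simpa using hδε

theorem exists_step_natBlocks_eLpNorm_sub_le (f : ℕ →ₘ[Measure.count] ℝ)
    (hf : MemLp f 2 Measure.count) {ε : ℝ≥0∞} (hε : ε ≠ 0) :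
    ∃ N : ℕ, ∀ n ≥ N, ∃ a, eLpNorm
      (f - step (natBlocks n) a : ℕ →ₘ[Measure.count] ℝ) 2 Measure.count ≤ ε := by
  obtain ⟨s, -, hs, hsε⟩ := hf.exists_eLpNorm_indicator_compl_lt ENNReal.ofNat_ne_top hε
  rw [Measure.count_apply_lt_top] at hs
  obtain ⟨N, hN⟩ := hs.bddAbove
  refine ⟨N, fun n hn => ⟨fun i => f i, le_trans (eLpNorm_mono_ae ?_) hsε.le⟩⟩
  filter_upwards [AEEqFun.coeFn_sub f (step (natBlocks n) fun i => f i),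
    step_ae_eq_of_mem (natBlocks n) fun i => f i,
    step_ae_eq_zero (natBlocks n) fun i => f i] with x hx h1 h2
  rw [hx, Pi.sub_apply]
  by_cases hxn : x < 2 ^ n
  · have : step (natBlocks n) (fun i => f i) x = f x := h1 ⟨x, hxn⟩ rfl
    rw [this, sub_self, norm_zero]
    exact norm_nonneg _
  -- N bounds s and N ≤ n < 2^n, so points beyond the blocks lie outside s.
  · have hxs : x ∉ s := fun h => hxn ((hN h).trans_lt (hn.trans_lt Nat.lt_two_pow_self))
    rw [h2 fun i (hi : x = i) => hxn (hi ▸ i.isLt), sub_zero,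
      Set.indicator_of_mem (Set.mem_compl hxs)]

/-- The blocks cover [0,1] up to a null set, so this step function is the characteristic function of
a set of measure 1, which the normalization covers. -/
theorem rho_step_dyadicBlocks_one {X : KotheSpace (volume : Measure unitInterval)} (hX : X.IsRI)
    (n : ℕ) : X.rho (step (dyadicBlocks n) fun _ => 1)
      = eLpNorm (step (dyadicBlocks n) fun _ => 1) 2 volume := by
  have hchi : (chi volume Set.univ MeasurableSet.univ : unitInterval →ₘ[volume] ℝ)
      =ᵐ[volume] fun _ => (1 : ℝ) := by
    filter_upwards [AEEqFun.coeFn_mk (μ := (volume : Measure unitInterval))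
      (Set.univ.indicator fun _ => (1 : ℝ))
      (stronglyMeasurable_const.indicator MeasurableSet.univ).aestronglyMeasurable] with x hx
    rw [chi, hx, Set.indicator_univ]
  have h1 : (step (dyadicBlocks n) fun _ => 1) = chi volume Set.univ MeasurableSet.univ := by
    apply AEEqFun.ext
    filter_upwards [ae_exists_mem_dyadicBlocks n, step_ae_eq_of_mem (dyadicBlocks n) fun _ => 1,
      hchi] with x ⟨i, hi⟩ h1 h2
    rw [h1 i hi, h2]
  rw [h1, hX.normalized _ _ measure_univ, eLpNorm_congr_ae hchi,
    eLpNorm_const _ two_ne_zero (NeZero.ne _)]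
  simp

/-- If the spans of arbitrarily fine systems of blocks carry the `L_2`-norm, so does `X`. -/
theorem IsRI.proportionalToLp_two {Ω : Type*} [MeasurableSpace Ω] {μ : Measure Ω} [SigmaFinite μ]
    {X : KotheSpace μ} (hX : X.IsRI) {ι : ℕ → Type*} [∀ n, Fintype (ι n)]
    (B : ∀ n, Blocks μ (ι n))
    (hdense : ∀ f : Ω →ₘ[μ] ℝ, MemLp f 2 μ → ∀ ε : ℝ≥0∞, ε ≠ 0 →
      ∃ N : ℕ, ∀ n ≥ N, ∃ a, eLpNorm (f - step (B n) a : Ω →ₘ[μ] ℝ) 2 μ ≤ ε)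
    (h : ∀ N : ℕ, ∃ n ≥ N, ∀ a, X.rho (step (B n) a) = eLpNorm (step (B n) a) 2 μ) :
    X.ProportionalToLp 2 := by
  refine ⟨1, fun f hf => ?_⟩
  rw [ENNReal.coe_one, one_mul]
  refine rho_eq_eLpNorm_two_of_dense hX.norming
    {g | ∃ n a, g = step (B n) a ∧ X.rho g = eLpNorm g 2 μ} ?_ ?_ (fun f hf ε hε => ?_) f hf
  · rintro _ ⟨n, a, rfl, -⟩
    exact X.rho_step_lt_top (B n) a
  · rintro _ ⟨n, a, -, h⟩
    exact h
  · obtain ⟨N, hN⟩ := hdense f hf ε hε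
    obtain ⟨n, hn, hB⟩ := h N
    obtain ⟨a, ha⟩ := hN n hn
    exact ⟨_, ⟨n, a, rfl, hB a⟩, ha⟩

end KotheSpace

/-! ### The three kinds of spaces -/

theorem proposition3p1 {H : Type*} [NormedAddCommGroup H] [InnerProductSpace ℝ H]
    [CompleteSpace H] [TopologicalSpace.SeparableSpace H] (hH : 2 ≤ Module.rank ℝ H) :
    -- function spaces on `[0,1]`
    (∀ X : KotheSpace (volume : Measure unitInterval), X.IsRI → X.PropertyP'Interval →
      (∀ p : ℝ≥0∞, 1 ≤ p → ¬ X.ProportionalToLp p) →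
      ∃ N : ℕ, ∀ n ≥ N, ∀ u : X.BlockSpace (dyadicBlocks n) H, IsFlinn u →
        ∃ i₀ : Fin (2 ^ n), ∀ i, i ≠ i₀ → u i = 0) ∧
    -- sequence spaces of finite dimension `d ≥ 3`, where `X_n = X` for all `n`
    (∀ d : ℕ, 3 ≤ d → ∀ X : KotheSpace (Measure.count : Measure (Fin d)),
      X.IsRI → X.PropertyP'Fin →
      (∀ p : ℝ≥0∞, 1 ≤ p → ¬ X.ProportionalToLp p) →
      ∀ u : X.BlockSpace (finBlocks d) H, IsFlinn u →
        ∃ i₀ : Fin d, ∀ i, i ≠ i₀ → u i = 0) ∧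
    -- sequence spaces of infinite dimension
    (∀ X : KotheSpace (Measure.count : Measure ℕ), X.IsRI → X.PropertyP'Nat →
      (∀ p : ℝ≥0∞, 1 ≤ p → ¬ X.ProportionalToLp p) →
      ∃ N : ℕ, ∀ n ≥ N, ∀ u : X.BlockSpace (natBlocks n) H, IsFlinn u →
        ∃ i₀ : Fin (2 ^ n), ∀ i, i ≠ i₀ → u i = 0) := by
  refine ⟨fun X hX _ hp => ?_, fun d hd X hX _ hp u hu => ?_, fun X hX _ hp => ?_⟩
  · by_contra! hcon
    refine hp 2 one_le_two (hX.proportionalToLp_two dyadicBlocks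
      (fun f hf ε hε => KotheSpace.exists_step_dyadicBlocks_eLpNorm_sub_le f hf hε) fun N => ?_)
    obtain ⟨n, hn, u, hu, hu'⟩ := hcon N
    refine ⟨n, hn, ?_⟩
    have hm : ∀ i, volume ((dyadicBlocks n).set i) = volume ((dyadicBlocks n).set 0) := by
      intro i
      obtain ⟨τ, hτ, hτ'⟩ := exists_measurePreserving_swap_dyadicBlocks n i 0
      rw [← hτ.measure_preimage ((dyadicBlocks n).measurable i).nullMeasurableSet, hτ',
        Equiv.swap_apply_left]
    have hs := hX.isSymmetric_of_swap (exists_measurePreserving_swap_dyadicBlocks n)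
    refine hs.rho_step_eq_eLpNorm_two hH hm (a₀ := fun _ => 1) (fun h => one_ne_zero (congrFun h 0))
      (KotheSpace.rho_step_dyadicBlocks_one hX n) hu ?_
    push Not
    exact hu'
  · by_contra hcon
    have hm : ∀ i, Measure.count ((finBlocks d).set i) = 1 := fun i => Measure.count_singleton i
    let i₀ : Fin d := ⟨0, by omega⟩
    -- With X_n = X every function is a step function, so the approximation is exact and a single
    -- Flinn element suffices.
    refine hp 2 one_le_two (hX.proportionalToLp_two (fun _ => finBlocks d)
      (fun f _ ε _ => ⟨0, fun _ _ => ⟨fun i => f i, ?_⟩⟩) fun N => ⟨N, le_rfl, ?_⟩)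
    · have h0 : f - KotheSpace.step (finBlocks d) (fun i => f i) = 0 := by
        rw [sub_eq_zero]
        apply AEEqFun.ext
        filter_upwards [KotheSpace.step_ae_eq_of_mem (finBlocks d) fun i => f i] with x hx
        exact (hx x rfl).symm
      rw [h0, eLpNorm_congr_ae AEEqFun.coeFn_zero, eLpNorm_zero]
      exact zero_le
    · exact hX.isSymmetric_finBlocks.rho_step_eq_eLpNorm_two hH hm (a₀ := Pi.single i₀ 1) (by simp)
        (KotheSpace.rho_step_single hX _ hm i₀) hu hcon
  · by_contra! hcon
    refine hp 2 one_le_two (hX.proportionalToLp_two natBlocks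
      (fun f hf ε hε => KotheSpace.exists_step_natBlocks_eLpNorm_sub_le f hf hε) fun N => ?_)
    obtain ⟨n, hn, u, hu, hu'⟩ := hcon N
    have hm : ∀ i, Measure.count ((natBlocks n).set i) = 1 := fun i => Measure.count_singleton _
    refine ⟨n, hn, hX.isSymmetric_natBlocks.rho_step_eq_eLpNorm_two hH hm (a₀ := Pi.single 0 1)
      (by simp) (KotheSpace.rho_step_single hX _ hm 0) hu ?_⟩
    push Not
    exact hu'
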